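/- **Theorem 1.1 (Strong solution).** Let $S=\{S_t\}_{t\ge0}$ be a driftless subordinator with $S_0=0$, defined on a probability space $(\Omega,\mathcal F,\mathbb P)$, with Lévy measure $\nu$; that is, $\nu$ is a measure on $(0,\infty)$ with $\int_0^\infty\min\{1,x\}\,\nu(dx)<\infty$ and $\mathbb E[e^{-\lambda S_t}]=\exp\big(-t\int_0^\infty(1-e^{-\lambda x})\,\nu(dx)\big)$ for $\lambda>0$, $t\ge0$. Assume that $\nu(0,\infty)=\infty$ and that for every $r>0$ the law of $S_r$ has a bounded density $\bar p(r,\cdot)$ on $(0,\infty)$, where $\bar p$ is jointly measurable. Put $w(x)=\nu(x,\infty)$ for $x>0$ and $E_t=\inf\{s>0:S_s>t\}$. Let $\{P^0_t\}_{t\ge0}$ be a uniformly bounded strongly continuous semigroup on a Banach space $(\mathbb B,\|\cdot\|)$ with infinitesimal generator $(\mathcal L,\mathcal D(\mathcal L))$. Let $T_0\in(0,\infty)$, let $g\in\mathcal D(\mathcal L)$, and let $f:(0,T_0]\to\mathbb B$ be strongly measurable with $f(t)\in\mathcal D(\mathcal L)$ and $\|f(t)\|\le K<\infty$ for a.e.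 $t\in(0,T_0]$, and $\int_0^{T_0}\|\mathcal L f(t)\|\,dt<\infty$. For $t\in(0,T_0]$ put $$u(t)=\mathbb E\big[P^0_{E_t}g\big]+\int_0^t\int_0^\infty P^0_r f(s)\,\bar p(r,t-s)\,dr\,ds .$$ Then all integrals involved converge absolutely, also $$u(t)=\mathbb E\big[P^0_{E_t}g\big]+\mathbb E\Big[\int_0^\infty \mathbf 1_{\{S_r<t\}}\,P^0_r f(t-S_r)\,dr\Big]\qquad(0<t\le T_0),$$ again with absolutely convergent integrals, and $u$ is the unique strong solution of $\partial^w_t u=\mathcal L u+f$ on $(0,T_0]$ with $u(0)=g$. Here $\partial^w_t u(t)=\frac{d}{dt}\int_0^t w(t-s)(u(s)-u(0))\,ds$, and a function $u:(0,T_0]\to\mathbb B$ is called a strong solution if 1. $\sup_{0<t\le T_0}\|u(t)\|<\infty$, $t\mapsto u(t)$ is continuous on $(0,T_0]$ in $(\mathbb B,\|\cdot\|)$, and $\lim_{t\downarrow0}\|u(t)-g\|=0$; 2. $u(t)\in\mathcal D(\mathcal L)$ for a.e. $t\in(0,T_0]$, and $\int_0^{T_0}\|\mathcal L u(t)\|\,dt<\infty$;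 3. for every $T\in(0,T_0]$ the integral $\int_0^T w(T-t)(u(t)-g)\,dt$ converges absolutely in $\mathbb B$ and $$\int_0^T w(T-t)\,(u(t)-g)\,dt=\int_0^T\big(f(t)+\mathcal L u(t)\big)\,dt .$$ Uniqueness means that any strong solution coincides with $u$ at every $t\in(0,T_0]$. -/

import Mathlib

open MeasureTheory ProbabilityTheory Filter Topology Set

noncomputable section

namespace TimeFractional

/-! ### Semigroups and generators

Time is a real variable throughout; only the values at times `t ≥ 0` are relevant. -/

section Semigroup

variable {B : Type*} [NormedAddCommGroup B] [NormedSpace ℝ B]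

/-- `P` is a uniformly bounded, strongly continuous semigroup of bounded linear operators. -/
structure IsBoundedC0Semigroup (P : ℝ → B →L[ℝ] B) : Prop where
  zero : P 0 = ContinuousLinearMap.id ℝ B
  add : ∀ s t : ℝ, 0 ≤ s → 0 ≤ t → P (s + t) = (P s).comp (P t)
  tendsto_zero : ∀ x : B, Tendsto (fun t => P t x) (𝓝[>] 0) (𝓝 x)
  bounded : ∃ M : ℝ, ∀ t : ℝ, 0 ≤ t → ‖P t‖ ≤ M

/-- The domain of the infinitesimal generator of `P`. -/
def genDomain (P : ℝ → B →L[ℝ] B) : Set B :=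
  {x | ∃ y : B, Tendsto (fun h : ℝ => h⁻¹ • (P h x - x)) (𝓝[>] 0) (𝓝 y)}

/-- The infinitesimal generator of `P`: the norm limit of `(P h x - x) / h` as `h ↓ 0` for `x` in
`genDomain P`, and `0` (a value which is never relevant) otherwise. -/
def gen (P : ℝ → B →L[ℝ] B) (x : B) : B :=
  open Classical in
  if hx : ∃ y : B, Tendsto (fun h : ℝ => h⁻¹ • (P h x - x)) (𝓝[>] 0) (𝓝 y) then hx.choose else 0

end Semigroup

/-! ### Subordinators -/

section Subordinator

variable {Ω : Type*} [MeasurableSpace Ω]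

/-- `S` is a (finite-valued) subordinator on `[0, ∞)` started at `0`: a process with independent and
stationary increments whose paths are almost surely nondecreasing and right continuous. -/
structure IsSubordinator (S : ℝ → Ω → ℝ) (μ : Measure Ω) : Prop where
  measurable : ∀ t : ℝ, 0 ≤ t → Measurable (S t)
  zero : ∀ᵐ ω ∂μ, S 0 ω = 0
  indep : HasIndepIncrements (fun (t : NNReal) ω => S (t : ℝ) ω) μ
  stationary : ∀ s t : ℝ, 0 ≤ s → 0 ≤ t →
    IdentDistrib (fun ω => S (s + t) ω - S s ω) (S t) μ μ
  monotone : ∀ᵐ ω ∂μ, MonotoneOn (fun t => S t ω) (Ici 0)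
  right_continuous : ∀ᵐ ω ∂μ, ∀ t : ℝ, 0 ≤ t → ContinuousWithinAt (fun s => S s ω) (Ioi t) t

/-- `ν` is a Lévy measure on `(0, ∞)` with `∫ min(1, x) ν(dx) < ∞`. -/
structure IsSubordinatorLevyMeasure (ν : Measure ℝ) : Prop where
  support : ν (Iic 0) = 0
  lintegral_lt_top : ∫⁻ x, ENNReal.ofReal (min 1 x) ∂ν < ⊤

/-- The driftless Laplace exponent `φ(l) = ∫ (1 - exp (-l x)) ν(dx)`. -/
def laplaceExponent (ν : Measure ℝ) (l : ℝ) : ℝ :=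
  ∫ x, (1 - Real.exp (-(l * x))) ∂ν

/-- `S` is a driftless subordinator with Lévy measure `ν`. -/
structure IsDriftlessSubordinator (S : ℝ → Ω → ℝ) (ν : Measure ℝ) (μ : Measure Ω) : Prop where
  subordinator : IsSubordinator S μ
  levy : IsSubordinatorLevyMeasure ν
  laplace : ∀ l t : ℝ, 0 < l → 0 ≤ t →
    ∫ ω, Real.exp (-(l * S t ω)) ∂μ = Real.exp (-(t * laplaceExponent ν l))

/-- `p` is a jointly measurable family of bounded densities: for every `r > 0`, the law of `S r` has
the bounded density `p r` on `(0, ∞)`. -/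
structure HasBoundedDensities (S : ℝ → Ω → ℝ) (μ : Measure Ω) (p : ℝ → ℝ → ℝ) : Prop where
  measurable : Measurable (Function.uncurry p)
  nonneg : ∀ r x : ℝ, 0 < r → 0 < x → 0 ≤ p r x
  bounded : ∀ r : ℝ, 0 < r → ∃ C : ℝ, ∀ x : ℝ, 0 < x → p r x ≤ C
  law : ∀ r : ℝ, 0 < r →
    μ.map (S r) = (volume.restrict (Ioi 0)).withDensity (fun x => ENNReal.ofReal (p r x))

/-- The inverse subordinator `E_t = inf {s > 0 : S_s > t}`. -/
def inverseSubordinator (S : ℝ → Ω → ℝ) (t : ℝ) (ω : Ω) : ℝ :=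
  sInf {s : ℝ | 0 < s ∧ t < S s ω}

/-- The weight `w(x) = ν (x, ∞)`; it is finite for `x > 0` when `ν` is a Lévy measure as above. -/
def weight (ν : Measure ℝ) (x : ℝ) : ℝ :=
  (ν (Ioi x)).toReal

end Subordinator

/-! ### Strong solutions -/

section Solution

variable {B : Type*} [NormedAddCommGroup B] [NormedSpace ℝ B]

/-- `u` is a strong solution on `(0, T₀]` of `∂ʷ u = L u + f`, `u(0) = g`, where `w` is the weight of
`ν` and `L` is the generator of `P`. -/
structure IsStrongSolution (ν : Measure ℝ) (P : ℝ → B →L[ℝ] B) (T₀ : ℝ) (f : ℝ → B) (g : B)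
    (u : ℝ → B) : Prop where
  bounded : ∃ C : ℝ, ∀ t ∈ Ioc 0 T₀, ‖u t‖ ≤ C
  continuousOn : ContinuousOn u (Ioc 0 T₀)
  initial : Tendsto u (𝓝[>] 0) (𝓝 g)
  mem_domain : ∀ᵐ t ∂(volume.restrict (Ioc 0 T₀)), u t ∈ genDomain P
  integrable_gen : IntegrableOn (fun t => gen P (u t)) (Ioc 0 T₀)
  integrable_weight : ∀ T ∈ Ioc 0 T₀, IntegrableOn (fun t => weight ν (T - t) • (u t - g)) (Ioc 0 T)
  equation : ∀ T ∈ Ioc 0 T₀,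
    ∫ t in Ioc 0 T, weight ν (T - t) • (u t - g) = ∫ t in Ioc 0 T, (f t + gen P (u t))

/-- `u(t) = 𝔼[P_{E_t} g] + ∫_0^t ∫_0^∞ p(r, t - s) P_r f(s) dr ds`. -/
def solution {Ω : Type*} [MeasurableSpace Ω] (S : ℝ → Ω → ℝ) (μ : Measure Ω) (p : ℝ → ℝ → ℝ)
    (P : ℝ → B →L[ℝ] B) (f : ℝ → B) (g : B) (t : ℝ) : B :=
  (∫ ω, P (inverseSubordinator S t ω) g ∂μ) +
    ∫ s in Ioc 0 t, ∫ r in Ioi (0 : ℝ), p r (t - s) • P r (f s)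

end Solution

end TimeFractional

end

/-!
Why the theorem holds. Let `m` be the space-time potential measure `P (S_r ∈ dx) dr` of the
subordinator (`potentialMeasure`), let `w(y) dy` be the tail measure of `ν` (`tailMeasure`), and let
a measure on (position, subordinator time) act on a function `F : ℝ → B` by
`t ↦ ∫ P_r F(t - x) m(dx, dr)` (`timeConv`). The position of the subordinator is the time of the
equation. Everything follows from the behaviour of `m` under convolution in the position variable.

* The measure `Q = w * m` consists of the laws of the inverse subordinator `E_x`. Two facts are
  needed: for almost every `x` these are probability measures (`map_fst_spaceConv`), and
  `P (E_x > r) = P (S_r ≤ x)`, in the form that `1 * m` is the image of `Q` under integration of its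
  tails (`spaceConv_volume`). Both follow from the uniqueness of Laplace transforms
  (`ext_of_lintegral_expNeg`), since the transform of `Q` restricted to times beyond `R` is
  `exp (-R φ(l)) / l`.
* Integrating `P_ρ h - h = ∫_0^ρ P_r L h dr` against `Q` therefore gives
  `Q F = 1 * F + (1 * m) (L F)` for functions `F` with values in the domain of `L`
  (`integral_apply_eq_add`, `IsRegular.timeConv_eq_add`).

Existence. The candidate is `u = g + m (L g + f)` on `(0, T₀]`: the representation
`E[P_{E_t} g] = g + ∫_0^∞ P (S_r ≤ t) P_r L g dr` (`inverseSubordinator_integral`) treats the first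
term, and `inhomogeneous_term` the second one in both of its forms. Then
`w * (u - g) = Q (L g) + Q f`. Here `Q f = 1 * (f + m (L f))` by the identity above, and `Q (L g)` is
the primitive of `A_t L g`, where `A_t` integrates `P_r` against the law of `E_t`; the same identity
shows that `A_t g = g + m (L g)` for almost all `t`, so that `A_t L g = L A_t g`
(`exists_gen_homogeneous`). The boundedness of the densities enters only in the continuity of `u`:
the convolution of a bounded density with an integrable function is continuous.

Uniqueness. The difference `d` of two solutions satisfies `w * d = 1 * L d`. Applying `m` gives
`Q d = (1 * m) (L d)`, while `Q d = 1 * d + (1 * m) (L d)`; hence `1 * d = 0` and `d = 0`.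
-/

namespace TimeFractional

/-! ### Generators of bounded semigroups -/

section Generator

variable {B : Type*} [NormedAddCommGroup B] [NormedSpace ℝ B] {P : ℝ → B →L[ℝ] B}

/-- The graph of the generator of `P`: `x` lies in its domain and is mapped to `y`. -/
def HasGenAt (P : ℝ → B →L[ℝ] B) (x y : B) : Prop :=
  Tendsto (fun h : ℝ => h⁻¹ • (P h x - x)) (𝓝[>] 0) (𝓝 y)

lemma HasGenAt.mem_genDomain {x y : B} (h : HasGenAt P x y) : x ∈ genDomain P := ⟨y, h⟩

lemma hasGenAt_gen {x : B} (hx : x ∈ genDomain P) : HasGenAt P x (gen P x) := by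
  have h : ∃ y : B, Tendsto (fun h : ℝ => h⁻¹ • (P h x - x)) (𝓝[>] 0) (𝓝 y) := hx
  rw [gen, dif_pos h]
  exact h.choose_spec

lemma HasGenAt.gen_eq {x y : B} (h : HasGenAt P x y) : gen P x = y :=
  tendsto_nhds_unique (hasGenAt_gen h.mem_genDomain) h

lemma hasGenAt_zero : HasGenAt P 0 0 := by simp [HasGenAt]

lemma HasGenAt.add {x y x' y' : B} (h : HasGenAt P x y) (h' : HasGenAt P x' y') :
    HasGenAt P (x + x') (y + y') := by
  refine (Tendsto.add h h').congr fun t => ?_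
  rw [map_add, ← smul_add]
  congr 1
  abel

lemma HasGenAt.sub {x y x' y' : B} (h : HasGenAt P x y) (h' : HasGenAt P x' y') :
    HasGenAt P (x - x') (y - y') := by
  refine (Tendsto.sub h h').congr fun t => ?_
  rw [map_sub, ← smul_sub]
  congr 1
  abel

lemma IsBoundedC0Semigroup.exists_bound (hP : IsBoundedC0Semigroup P) :
    ∃ M : ℝ, 0 ≤ M ∧ ∀ t : ℝ, 0 ≤ t → ∀ x, ‖P t x‖ ≤ M * ‖x‖ := by
  obtain ⟨M, hM⟩ := hP.bounded
  exact ⟨M, (norm_nonneg _).trans (hM 0 le_rfl), fun t ht x => (P t).le_of_opNorm_le (hM t ht) x⟩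

lemma HasGenAt.apply (hP : IsBoundedC0Semigroup P) {x y : B} (h : HasGenAt P x y) {t : ℝ}
    (ht : 0 ≤ t) : HasGenAt P (P t x) (P t y) := by
  refine (((P t).continuous.tendsto y).comp h).congr' ?_
  filter_upwards [self_mem_nhdsWithin] with s hs
  have hs : (0 : ℝ) ≤ s := le_of_lt hs
  have : P s (P t x) = P t (P s x) := by
    rw [← ContinuousLinearMap.comp_apply, ← hP.add s t hs ht, add_comm, hP.add t s ht hs,
      ContinuousLinearMap.comp_apply]
  simp [this, map_sub]

lemma IsBoundedC0Semigroup.continuousOn_apply (hP : IsBoundedC0Semigroup P) (x : B) :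
    ContinuousOn (fun t => P t x) (Ici 0) := by
  obtain ⟨M, hM0, hM⟩ := hP.exists_bound
  have key : ∀ s t : ℝ, 0 ≤ s → 0 ≤ t → ‖P s x - P t x‖ ≤ M * ‖P |s - t| x - x‖ := by
    have aux : ∀ s t : ℝ, 0 ≤ s → s ≤ t → ‖P t x - P s x‖ ≤ M * ‖P (t - s) x - x‖ := by
      intro s t hs hst
      have : P t x = P s (P (t - s) x) := by
        rw [← ContinuousLinearMap.comp_apply, ← hP.add s (t - s) hs (by linarith)]
        congr 2
        ring
      rw [this, ← map_sub]
      exact hM s hs _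
    intro s t hs ht
    rcases le_total s t with h | h
    · rw [norm_sub_rev, abs_sub_comm, abs_of_nonneg (by linarith)]
      exact aux s t hs h
    · rw [abs_of_nonneg (by linarith)]
      exact aux t s ht h
  have h0 : Tendsto (fun r => ‖P r x - x‖) (𝓝[≥] 0) (𝓝 0) := by
    have h1 : ContinuousWithinAt (fun r => P r x) (Ici 0) 0 := by
      rw [← continuousWithinAt_Ioi_iff_Ici, ContinuousWithinAt, hP.zero]
      exact hP.tendsto_zero x
    rw [ContinuousWithinAt, hP.zero] at h1
    simpa using (h1.sub_const x).norm
  intro t ht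
  rw [ContinuousWithinAt, tendsto_iff_norm_sub_tendsto_zero]
  have h2 : Tendsto (fun s : ℝ => |s - t|) (𝓝[Ici 0] t) (𝓝[≥] 0) := by
    refine tendsto_nhdsWithin_iff.2 ⟨?_, Eventually.of_forall fun s => mem_Ici.2 (abs_nonneg _)⟩
    have : Continuous fun s : ℝ => |s - t| := by fun_prop
    simpa using (this.tendsto t).mono_left nhdsWithin_le_nhds
  have h3 := (h0.comp h2).const_mul M
  rw [mul_zero] at h3
  refine squeeze_zero' (Eventually.of_forall fun s => norm_nonneg _) ?_ h3
  filter_upwards [self_mem_nhdsWithin] with s hs using key s t hs ht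

/-- Joint continuity of the semigroup in time and space; negative times are frozen at `0`. -/
lemma IsBoundedC0Semigroup.continuous_uncurry (hP : IsBoundedC0Semigroup P) :
    Continuous fun q : ℝ × B => P (max q.1 0) q.2 := by
  obtain ⟨M, hM0, hM⟩ := hP.exists_bound
  rw [continuous_iff_continuousAt]
  rintro ⟨t, x⟩
  rw [ContinuousAt, tendsto_iff_norm_sub_tendsto_zero]
  have hc : Continuous fun s : ℝ => P (max s 0) x :=
    (hP.continuousOn_apply x).comp_continuous (by fun_prop) fun s => mem_Ici.2 (le_max_right _ _)
  have h1 : Tendsto (fun q : ℝ × B => M * ‖q.2 - x‖ + ‖P (max q.1 0) x - P (max t 0) x‖)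
      (𝓝 (t, x)) (𝓝 0) := by
    have : Continuous fun q : ℝ × B => M * ‖q.2 - x‖ + ‖P (max q.1 0) x - P (max t 0) x‖ := by
      have h2 : Continuous fun q : ℝ × B => P (max q.1 0) x := hc.comp continuous_fst
      exact ((continuous_snd.sub continuous_const).norm.const_mul M).add
        (h2.sub continuous_const).norm
    simpa using this.tendsto (t, x)
  refine squeeze_zero (fun _ => norm_nonneg _) (fun q => ?_) h1
  have : P (max q.1 0) q.2 - P (max t 0) x
      = P (max q.1 0) (q.2 - x) + (P (max q.1 0) x - P (max t 0) x) := by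
    rw [map_sub]; abel
  rw [this]
  exact (norm_add_le _ _).trans (add_le_add (hM _ (le_max_right _ _) _) le_rfl)

lemma IsBoundedC0Semigroup.aestronglyMeasurable_apply (hP : IsBoundedC0Semigroup P)
    {α : Type*} [MeasurableSpace α] {m : Measure α} {τ : α → ℝ} {F : α → B}
    (hτ : AEMeasurable τ m) (hF : AEStronglyMeasurable F m) (h0 : ∀ᵐ a ∂m, 0 ≤ τ a) :
    AEStronglyMeasurable (fun a => P (τ a) (F a)) m := by
  have := hP.continuous_uncurry.comp_aestronglyMeasurable
    (hτ.aestronglyMeasurable.prodMk hF)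
  refine this.congr ?_
  filter_upwards [h0] with a ha
  simp [max_eq_left ha]

lemma IsBoundedC0Semigroup.integrable_apply (hP : IsBoundedC0Semigroup P)
    {α : Type*} [MeasurableSpace α] {m : Measure α} {τ : α → ℝ} {F : α → B}
    (hτ : AEMeasurable τ m) (hF : Integrable F m) (h0 : ∀ᵐ a ∂m, 0 ≤ τ a) :
    Integrable (fun a => P (τ a) (F a)) m := by
  obtain ⟨M, hM0, hM⟩ := hP.exists_bound
  refine (hF.norm.const_mul M).mono' (hP.aestronglyMeasurable_apply hτ hF.1 h0) ?_
  filter_upwards [h0] with a ha using hM _ ha _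

variable [CompleteSpace B]

lemma HasGenAt.integral_apply (hP : IsBoundedC0Semigroup P) {x y : B} (h : HasGenAt P x y)
    {a : ℝ} (ha : 0 ≤ a) : ∫ r in Ioc 0 a, P r y = P a x - x := by
  rw [← intervalIntegral.integral_of_le ha]
  have hc : ∀ z, ContinuousOn (fun t => P t z) (Icc 0 a) := fun z =>
    (hP.continuousOn_apply z).mono Icc_subset_Ici_self
  rw [intervalIntegral.integral_eq_sub_of_hasDeriv_right_of_le (f := fun r => P r x) ha (hc x) _
    ((hc y).intervalIntegrable_of_Icc ha)]
  · simp [hP.zero]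
  · intro t ht
    rw [hasDerivWithinAt_iff_tendsto_slope' (by simp)]
    have h1 := h.apply hP ht.1.le
    have h2 : Tendsto (fun s : ℝ => s - t) (𝓝[>] t) (𝓝[>] 0) := by
      refine tendsto_nhdsWithin_iff.2 ⟨?_, ?_⟩
      · have : Continuous fun s : ℝ => s - t := by fun_prop
        simpa using (this.tendsto t).mono_left nhdsWithin_le_nhds
      · filter_upwards [self_mem_nhdsWithin] with s hs
        simpa using hs
    refine (h1.comp h2).congr' ?_
    filter_upwards [self_mem_nhdsWithin] with s hs
    have hs : t < s := hs
    simp only [Function.comp_apply, slope_def_module]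
    rw [← ContinuousLinearMap.comp_apply, ← hP.add _ _ (by linarith) ht.1.le]
    simp

lemma HasGenAt.norm_sub_le (hP : IsBoundedC0Semigroup P) {M : ℝ}
    (hM : ∀ t : ℝ, 0 ≤ t → ∀ x, ‖P t x‖ ≤ M * ‖x‖) {x y : B} (h : HasGenAt P x y)
    {a : ℝ} (ha : 0 ≤ a) : ‖P a x - x‖ ≤ M * ‖y‖ * a := by
  rw [← h.integral_apply hP ha]
  have := norm_setIntegral_le_of_norm_le_const (μ := volume) (s := Ioc 0 a)
    (f := fun r => P r y) (C := M * ‖y‖) (by simp) fun r hr => hM r hr.1.le y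
  simpa [Measure.real, ha] using this

/-- The generator is closed under Bochner integration. -/
lemma HasGenAt.integral (hP : IsBoundedC0Semigroup P) {α : Type*} [MeasurableSpace α]
    {m : Measure α} {F H : α → B} (hF : Integrable F m) (hH : Integrable H m)
    (h : ∀ᵐ a ∂m, HasGenAt P (F a) (H a)) : HasGenAt P (∫ a, F a ∂m) (∫ a, H a ∂m) := by
  obtain ⟨M, hM0, hM⟩ := hP.exists_bound
  have h1 : Tendsto (fun s : ℝ => ∫ a, s⁻¹ • (P s (F a) - F a) ∂m) (𝓝[>] 0)
      (𝓝 (∫ a, H a ∂m)) := by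
    refine tendsto_integral_filter_of_dominated_convergence (fun a => M * ‖H a‖) ?_ ?_
      (hH.norm.const_mul M) h
    · exact Eventually.of_forall fun s =>
        ((((P s).integrable_comp hF).sub hF).1).const_smul _
    · filter_upwards [self_mem_nhdsWithin] with s hs
      have hs : 0 < s := hs
      filter_upwards [h] with a ha
      rw [norm_smul, norm_inv, Real.norm_of_nonneg hs.le, inv_mul_le_iff₀ hs, mul_comm]
      exact ha.norm_sub_le hP hM hs.le
  refine h1.congr fun s => ?_
  rw [integral_smul, integral_sub ((P s).integrable_comp hF) hF,
    ContinuousLinearMap.integral_comp_comm _ hF]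

end Generator

/-! ### Laplace transforms of measures on the line -/

section Laplace

lemma measurable_expNeg (l : ℝ) : Measurable fun x : ℝ => ENNReal.ofReal (Real.exp (-(l * x))) := by
  fun_prop

/-- A measure on `ℝ` with a finite (two-sided) Laplace transform on `(0, ∞)` is determined by it.
Weighting by `exp (-x)` gives finite measures whose complex moment generating functions are
holomorphic on `{re < 1}` and agree on the reals there, hence on the imaginary axis. -/
lemma ext_of_lintegral_expNeg {η₁ η₂ : Measure ℝ}
    (hfin : ∀ l : ℝ, 0 < l → ∫⁻ x, ENNReal.ofReal (Real.exp (-(l * x))) ∂η₁ ≠ ⊤)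
    (heq : ∀ l : ℝ, 0 < l → ∫⁻ x, ENNReal.ofReal (Real.exp (-(l * x))) ∂η₁ =
      ∫⁻ x, ENNReal.ofReal (Real.exp (-(l * x))) ∂η₂) : η₁ = η₂ := by
  set e : ℝ → ENNReal := fun x => ENNReal.ofReal (Real.exp (-(1 * x))) with he
  have hem : Measurable e := measurable_expNeg 1
  have hexp : ∀ (η : Measure ℝ) (t : ℝ),
      ∫⁻ x, ENNReal.ofReal (Real.exp (t * x)) ∂(η.withDensity e)
        = ∫⁻ x, ENNReal.ofReal (Real.exp (-((1 - t) * x))) ∂η := by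
    intro η t
    rw [lintegral_withDensity_eq_lintegral_mul _ hem (by fun_prop)]
    refine lintegral_congr fun x => ?_
    simp only [Pi.mul_apply, he]
    rw [← ENNReal.ofReal_mul (Real.exp_nonneg _), ← Real.exp_add]
    congr 2
    ring
  have hint : ∀ (η : Measure ℝ),
      (∀ l : ℝ, 0 < l → ∫⁻ x, ENNReal.ofReal (Real.exp (-(l * x))) ∂η ≠ ⊤) →
      ∀ t < 1, Integrable (fun x : ℝ => Real.exp (t * x)) (η.withDensity e) := by
    intro η hη t ht
    refine ⟨by fun_prop, ?_⟩
    rw [hasFiniteIntegral_iff_ofReal (Eventually.of_forall fun x => Real.exp_nonneg _), hexp]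
    exact (hη _ (by linarith)).lt_top
  have hfin₂ : ∀ l : ℝ, 0 < l → ∫⁻ x, ENNReal.ofReal (Real.exp (-(l * x))) ∂η₂ ≠ ⊤ :=
    fun l hl => heq l hl ▸ hfin l hl
  have hfm : ∀ (η : Measure ℝ),
      (∀ l : ℝ, 0 < l → ∫⁻ x, ENNReal.ofReal (Real.exp (-(l * x))) ∂η ≠ ⊤) →
      IsFiniteMeasure (η.withDensity e) := fun η hη => isFiniteMeasure_withDensity (hη 1 one_pos)
  have := hfm η₁ hfin
  have := hfm η₂ hfin₂
  have hmgf : ∀ t < 1, mgf id (η₁.withDensity e) t = mgf id (η₂.withDensity e) t := by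
    intro t ht
    simp only [mgf, id]
    rw [integral_eq_lintegral_of_nonneg_ae (Eventually.of_forall fun x => Real.exp_nonneg _)
      (by fun_prop), integral_eq_lintegral_of_nonneg_ae
      (Eventually.of_forall fun x => Real.exp_nonneg _) (by fun_prop), hexp, hexp,
      heq _ (by linarith)]
  have han : ∀ (η : Measure ℝ),
      (∀ l : ℝ, 0 < l → ∫⁻ x, ENNReal.ofReal (Real.exp (-(l * x))) ∂η ≠ ⊤) →
      AnalyticOnNhd ℂ (complexMGF id (η.withDensity e)) {z : ℂ | z.re < 1} := by
    intro η hη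
    refine (analyticOnNhd_complexMGF (X := id) (μ := η.withDensity e)).mono fun z hz => ?_
    have hsub : Iio (1 : ℝ) ⊆ integrableExpSet id (η.withDensity e) := fun t ht => hint η hη t ht
    exact interior_mono hsub (by rw [interior_Iio]; exact hz)
  have heqOn : EqOn (complexMGF id (η₁.withDensity e)) (complexMGF id (η₂.withDensity e))
      {z : ℂ | z.re < 1} := by
    refine AnalyticOnNhd.eqOn_of_preconnected_of_frequently_eq (han η₁ hfin) (han η₂ hfin₂)
      (convex_halfSpace_re_lt 1).isPreconnected (z₀ := 0) (by simp) ?_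
    have h1 : Tendsto (fun t : ℝ => (t : ℂ)) (𝓝[<] 0) (𝓝[≠] 0) := by
      refine tendsto_nhdsWithin_iff.2 ⟨?_, ?_⟩
      · simpa using (Complex.continuous_ofReal.tendsto 0).mono_left nhdsWithin_le_nhds
      · filter_upwards [self_mem_nhdsWithin] with t ht
        simpa using (ne_of_lt ht : t ≠ 0)
    refine h1.frequently (Eventually.frequently ?_)
    filter_upwards [self_mem_nhdsWithin] with t ht
    have ht : t < 0 := ht
    rw [complexMGF_ofReal, complexMGF_ofReal, hmgf t (by linarith)]
  have hζ : η₁.withDensity e = η₂.withDensity e := by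
    refine Measure.ext_of_charFun ?_
    ext t
    rw [← complexMGF_id_mul_I, ← complexMGF_id_mul_I]
    exact heqOn (by simp)
  have h0 : ∀ x, e x ≠ 0 := fun x => by simp [he, Real.exp_pos]
  have h1 : ∀ x, e x ≠ ⊤ := fun x => by simp [he]
  rw [← withDensity_inv_same (μ := η₁) hem (Eventually.of_forall h0) (Eventually.of_forall h1), hζ,
    withDensity_inv_same (μ := η₂) hem (Eventually.of_forall h0) (Eventually.of_forall h1)]

lemma measure_Iic_lt_top_of_lintegral_expNeg {α : Type*} [MeasurableSpace α] {m : Measure α}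
    {X : α → ℝ} (h : ∫⁻ a, ENNReal.ofReal (Real.exp (-(1 * X a))) ∂m ≠ ⊤)
    (hX : Measurable X) (T : ℝ) : m {a | X a ≤ T} < ⊤ := by
  have h1 := mul_meas_ge_le_lintegral₀ (μ := m)
    (f := fun a => ENNReal.ofReal (Real.exp (-(1 * X a)))) (by fun_prop)
    (ENNReal.ofReal (Real.exp (-T)))
  have h2 : {a | X a ≤ T} =
      {a | ENNReal.ofReal (Real.exp (-T)) ≤ ENNReal.ofReal (Real.exp (-(1 * X a)))} := by
    ext a
    simp [ENNReal.ofReal_le_ofReal_iff (Real.exp_nonneg _)]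
  rw [h2]
  refine ENNReal.lt_top_of_mul_ne_top_right (h1.trans_lt h.lt_top).ne ?_
  simp [Real.exp_pos]

lemma lintegral_expNeg_Ioi {l : ℝ} (hl : 0 < l) (c : ℝ) :
    ∫⁻ x in Ioi c, ENNReal.ofReal (Real.exp (-(l * x))) =
      ENNReal.ofReal (Real.exp (-(l * c)) / l) := by
  have hi := integrableOn_exp_mul_Ioi (a := -l) (by linarith) c
  have := integral_exp_mul_Ioi (a := -l) (by linarith) c
  rw [← neg_mul, ← neg_div_neg_eq, ← this,
    ofReal_integral_eq_lintegral_ofReal hi (Eventually.of_forall fun x => Real.exp_nonneg _)]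
  simp_rw [neg_mul]

lemma lintegral_expNeg_Ioo {l : ℝ} (hl : 0 < l) {c : ℝ} (hc : 0 ≤ c) :
    ∫⁻ x in Ioo 0 c, ENNReal.ofReal (Real.exp (-(l * x))) =
      ENNReal.ofReal ((1 - Real.exp (-(l * c))) / l) := by
  rw [← ofReal_integral_eq_lintegral_ofReal _ (Eventually.of_forall fun x => Real.exp_nonneg _)]
  · congr 1
    rw [← integral_Ioc_eq_integral_Ioo, ← intervalIntegral.integral_of_le hc]
    rw [intervalIntegral.integral_eq_sub_of_hasDerivAt (f := fun x => -(Real.exp (-(l * x)) / l))]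
    · simp; ring
    · intro x _
      have h1 : Real.exp (-(l * x)) = -(Real.exp (-(l * x)) * -(l * 1) / l) := by
        field_simp
      rw [h1]
      exact ((((hasDerivAt_id x).const_mul l).neg).exp.div_const l).neg
    · exact Continuous.intervalIntegrable (by fun_prop) _ _
  · exact (Continuous.integrableOn_Icc (by fun_prop)).mono_set Ioo_subset_Icc_self

end Laplace

/-! ### The tail measure of a Lévy measure -/

section Tail

variable {ν : Measure ℝ}

/-- The measure `w(y) dy` on `(0, ∞)`, where `w(y) = ν (y, ∞)` is taken in `[0, ∞]`. -/
noncomputable def tailMeasure (ν : Measure ℝ) : Measure ℝ :=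
  (volume.restrict (Ioi 0)).withDensity fun y => ν (Ioi y)

lemma measurable_tail (ν : Measure ℝ) : Measurable fun y => ν (Ioi y) :=
  Antitone.measurable fun _ _ h => measure_mono (Ioi_subset_Ioi h)

instance (ν : Measure ℝ) : SFinite (tailMeasure ν) := by unfold tailMeasure; infer_instance

lemma IsSubordinatorLevyMeasure.ae_pos (hν : IsSubordinatorLevyMeasure ν) : ∀ᵐ x ∂ν, 0 < x := by
  rw [ae_iff]
  simpa [Iic] using hν.support

lemma IsSubordinatorLevyMeasure.sFinite (hν : IsSubordinatorLevyMeasure ν) : SFinite ν := by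
  have hm : Measurable fun x : ℝ => ENNReal.ofReal (min 1 x) := by fun_prop
  have : IsFiniteMeasure (ν.withDensity fun x : ℝ => ENNReal.ofReal (min 1 x)) :=
    isFiniteMeasure_withDensity hν.lintegral_lt_top.ne
  rw [← withDensity_inv_same (μ := ν) hm _ (by simp)]
  · infer_instance
  · filter_upwards [hν.ae_pos] with x hx
    simpa using hx

lemma IsSubordinatorLevyMeasure.integrable (hν : IsSubordinatorLevyMeasure ν) {l : ℝ}
    (hl : 0 < l) : Integrable (fun x => 1 - Real.exp (-(l * x))) ν := by
  have h1 : Integrable (fun x : ℝ => min 1 x) ν := by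
    refine ⟨by fun_prop, ?_⟩
    rw [hasFiniteIntegral_iff_ofReal]
    · exact hν.lintegral_lt_top
    · filter_upwards [hν.ae_pos] with x hx
      simpa using hx.le
  refine (h1.const_mul (max 1 l)).mono' (by fun_prop) ?_
  filter_upwards [hν.ae_pos] with x hx
  have h2 : Real.exp (-(l * x)) ≤ 1 := Real.exp_le_one_iff.2 (by nlinarith [mul_pos hl hx])
  have h3 := Real.add_one_le_exp (-(l * x))
  have h4 := Real.exp_pos (-(l * x))
  rw [Real.norm_of_nonneg (by linarith)]
  rcases le_total 1 x with h | h
  · rw [min_eq_left h]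
    linarith [le_max_left 1 l]
  · rw [min_eq_right h]
    nlinarith [le_max_right 1 l]

lemma IsSubordinatorLevyMeasure.laplaceExponent_pos (hν : IsSubordinatorLevyMeasure ν)
    (h : ν (Ioi 0) = ⊤) {l : ℝ} (hl : 0 < l) : 0 < laplaceExponent ν l := by
  have hpos : ∀ᵐ x ∂ν, 0 < 1 - Real.exp (-(l * x)) := by
    filter_upwards [hν.ae_pos] with x hx
    have : Real.exp (-(l * x)) < 1 := by
      rw [← Real.exp_zero]
      exact Real.exp_lt_exp.2 (by nlinarith [mul_pos hl hx])
    linarith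
  rw [laplaceExponent, integral_pos_iff_support_of_nonneg_ae
    (hpos.mono fun x hx => hx.le) (hν.integrable hl)]
  refine lt_of_lt_of_le (by rw [h]; simp) (measure_mono_ae (s := Ioi 0) ?_)
  filter_upwards [hpos] with x hx _ using hx.ne'

lemma IsSubordinatorLevyMeasure.lintegral_expNeg_tailMeasure
    (hν : IsSubordinatorLevyMeasure ν) {l : ℝ} (hl : 0 < l) :
    ∫⁻ y, ENNReal.ofReal (Real.exp (-(l * y))) ∂(tailMeasure ν) =
      ENNReal.ofReal (laplaceExponent ν l / l) := by
  have := hν.sFinite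
  rw [tailMeasure, lintegral_withDensity_eq_lintegral_mul _ (measurable_tail ν) (by fun_prop)]
  have h1 : ∀ y : ℝ, ((fun y => ν (Ioi y)) * fun y => ENNReal.ofReal (Real.exp (-(l * y)))) y
      = ∫⁻ x, (Ioi y).indicator (fun _ => ENNReal.ofReal (Real.exp (-(l * y)))) x ∂ν := by
    intro y
    rw [lintegral_indicator measurableSet_Ioi, setLIntegral_const, Pi.mul_apply, mul_comm]
  simp_rw [h1]
  have hms : MeasurableSet {q : ℝ × ℝ | q.1 < q.2} := measurableSet_lt measurable_fst measurable_snd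
  rw [lintegral_lintegral_swap]
  · have h2 : ∀ᵐ x ∂ν, ∫⁻ y in Ioi 0,
        (Ioi y).indicator (fun _ => ENNReal.ofReal (Real.exp (-(l * y)))) x =
        ENNReal.ofReal ((1 - Real.exp (-(l * x))) / l) := by
      filter_upwards [hν.ae_pos] with x hx
      rw [← lintegral_expNeg_Ioo hl hx.le, ← lintegral_indicator measurableSet_Ioi,
        ← lintegral_indicator measurableSet_Ioo]
      refine lintegral_congr fun y => ?_
      simp only [indicator, mem_Ioi, mem_Ioo]
      split_ifs <;> simp_all
    rw [lintegral_congr_ae h2, laplaceExponent, ← integral_div,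
      ofReal_integral_eq_lintegral_ofReal ((hν.integrable hl).div_const l)]
    filter_upwards [hν.ae_pos] with x hx
    have : Real.exp (-(l * x)) ≤ 1 := Real.exp_le_one_iff.2 (by nlinarith [mul_pos hl hx])
    exact div_nonneg (by linarith) hl.le
  · refine Measurable.aemeasurable ?_
    have : (Function.uncurry fun y x : ℝ =>
        (Ioi y).indicator (fun _ => ENNReal.ofReal (Real.exp (-(l * y)))) x) =
        {q : ℝ × ℝ | q.1 < q.2}.indicator fun q => ENNReal.ofReal (Real.exp (-(l * q.1))) := by
      ext q
      simp [Function.uncurry, indicator]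
    rw [this]
    exact Measurable.indicator (by fun_prop) hms

lemma IsSubordinatorLevyMeasure.tailMeasure_Iic_lt_top (hν : IsSubordinatorLevyMeasure ν) (T : ℝ) :
    tailMeasure ν (Iic T) < ⊤ :=
  measure_Iic_lt_top_of_lintegral_expNeg (X := fun y => y)
    (by rw [hν.lintegral_expNeg_tailMeasure one_pos]; simp) measurable_id T

lemma ae_tailMeasure_pos (ν : Measure ℝ) : ∀ᵐ y ∂(tailMeasure ν), 0 < y :=
  (withDensity_absolutelyContinuous _ _).ae_le (ae_restrict_mem measurableSet_Ioi)

lemma IsSubordinatorLevyMeasure.tail_lt_top (hν : IsSubordinatorLevyMeasure ν) {y : ℝ}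
    (hy : 0 < y) : ν (Ioi y) < ⊤ := by
  have h1 := mul_meas_ge_le_lintegral₀ (μ := ν) (f := fun x : ℝ => ENNReal.ofReal (min 1 x))
    (by fun_prop) (ENNReal.ofReal (min 1 y))
  refine lt_of_le_of_lt (measure_mono ?_) (ENNReal.lt_top_of_mul_ne_top_right
    (h1.trans_lt hν.lintegral_lt_top).ne (by simpa using hy))
  intro x hx
  exact ENNReal.ofReal_le_ofReal (min_le_min le_rfl (le_of_lt hx))

end Tail

/-! ### The potential measure of a subordinator -/

section Potential

variable {Ω : Type*} [MeasurableSpace Ω] {μ : Measure Ω} {S : ℝ → Ω → ℝ} {ν : Measure ℝ}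
  {p : ℝ → ℝ → ℝ}

/-- The space-time potential measure of `S`: the image of `dμ ⊗ dr` on `Ω × (0, ∞)` under
`(ω, r) ↦ (S r ω, r)`. The first coordinate is the position, the second one the time of the
subordinator. -/
noncomputable def potentialMeasure (S : ℝ → Ω → ℝ) (μ : Measure Ω) : Measure (ℝ × ℝ) :=
  (μ.prod (volume.restrict (Ioi 0))).map fun q => (S q.2 q.1, q.2)

instance [SFinite μ] : SFinite (potentialMeasure S μ) := by unfold potentialMeasure; infer_instance

/-- Joint measurability of `(ω, r) ↦ S r ω` up to null sets: by right continuity of the paths, `S`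
is the limit of the step processes that use the values at the points `(⌊n r⌋ + 1) / n`. -/
lemma IsSubordinator.aemeasurable_uncurry [SFinite μ] (hS : IsSubordinator S μ) :
    AEMeasurable (fun q : Ω × ℝ => S q.2 q.1) (μ.prod (volume.restrict (Ioi 0))) := by
  let a : ℕ → ℝ → ℝ := fun n r => ((⌊((n : ℝ) + 1) * r⌋₊ : ℝ) + 1) / ((n : ℝ) + 1)
  refine aemeasurable_of_tendsto_metrizable_ae (f := fun n (q : Ω × ℝ) => S (a n q.2) q.1) atTop
    (fun n => Measurable.aemeasurable ?_) ?_
  · have h1 : Measurable fun q : Ω × ℕ => S (((q.2 : ℝ) + 1) / ((n : ℝ) + 1)) q.1 :=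
      measurable_from_prod_countable_left fun k =>
        hS.measurable (((k : ℝ) + 1) / ((n : ℝ) + 1)) (by positivity)
    have h2 : Measurable fun q : Ω × ℝ => (q.1, ⌊((n : ℝ) + 1) * q.2⌋₊) :=
      measurable_fst.prodMk (Nat.measurable_floor.comp (by fun_prop))
    exact h1.comp h2
  · have h1 : ∀ᵐ q ∂(μ.prod (volume.restrict (Ioi (0 : ℝ)))), ∀ t : ℝ, 0 ≤ t →
        ContinuousWithinAt (fun s => S s q.1) (Ioi t) t :=
      Measure.quasiMeasurePreserving_fst.ae hS.right_continuous
    have h2 : ∀ᵐ q ∂(μ.prod (volume.restrict (Ioi (0 : ℝ)))), 0 < q.2 :=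
      Measure.quasiMeasurePreserving_snd.ae (ae_restrict_mem measurableSet_Ioi)
    filter_upwards [h1, h2] with q hq hr
    refine (hq q.2 hr.le).tendsto.comp (tendsto_nhdsWithin_iff.2 ⟨?_, Eventually.of_forall fun n => ?_⟩)
    · have h3 : Tendsto (fun n : ℕ => q.2 + 1 / ((n : ℝ) + 1)) atTop (𝓝 q.2) := by
        simpa using tendsto_one_div_add_atTop_nhds_zero_nat.const_add q.2
      refine tendsto_of_tendsto_of_tendsto_of_le_of_le tendsto_const_nhds h3 (fun n => ?_) fun n => ?_
      · have hn : (0 : ℝ) < (n : ℝ) + 1 := by positivity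
        rw [le_div_iff₀ hn, mul_comm]
        exact (Nat.lt_floor_add_one _).le
      · have hn : (0 : ℝ) < (n : ℝ) + 1 := by positivity
        have h4 := Nat.floor_le (a := ((n : ℝ) + 1) * q.2) (by positivity)
        simp only [a]
        rw [div_le_iff₀ hn, add_mul q.2, one_div, inv_mul_cancel₀ hn.ne', mul_comm q.2]
        linarith
    · have hn : (0 : ℝ) < (n : ℝ) + 1 := by positivity
      simp only [a, mem_Ioi]
      rw [lt_div_iff₀ hn, mul_comm]
      exact Nat.lt_floor_add_one _

lemma IsSubordinator.aemeasurable_graph [SFinite μ] (hS : IsSubordinator S μ) :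
    AEMeasurable (fun q : Ω × ℝ => (S q.2 q.1, q.2)) (μ.prod (volume.restrict (Ioi 0))) :=
  hS.aemeasurable_uncurry.prodMk measurable_snd.aemeasurable

lemma IsSubordinator.lintegral_potentialMeasure [SFinite μ] (hS : IsSubordinator S μ)
    {φ : ℝ × ℝ → ENNReal} (hφ : Measurable φ) :
    ∫⁻ z, φ z ∂(potentialMeasure S μ) = ∫⁻ r in Ioi 0, ∫⁻ ω, φ (S r ω, r) ∂μ := by
  rw [potentialMeasure, lintegral_map' hφ.aemeasurable hS.aemeasurable_graph,
    lintegral_prod_symm _ (by exact hφ.comp_aemeasurable hS.aemeasurable_graph)]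

lemma HasBoundedDensities.ae_pos (hS : IsSubordinator S μ) (hp : HasBoundedDensities S μ p)
    {r : ℝ} (hr : 0 < r) : ∀ᵐ ω ∂μ, 0 < S r ω := by
  have h : ∀ᵐ x ∂(μ.map (S r)), 0 < x := by
    rw [hp.law r hr]
    exact (withDensity_absolutelyContinuous _ _).ae_le (ae_restrict_mem measurableSet_Ioi)
  exact ae_of_ae_map (hS.measurable r hr.le).aemeasurable h

/-- In terms of the densities, the potential measure is `p r x dx dr` on `(0, ∞)²`. -/
lemma HasBoundedDensities.potentialMeasure_eq [SFinite μ] (hS : IsSubordinator S μ)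
    (hp : HasBoundedDensities S μ p) :
    potentialMeasure S μ = ((volume.restrict (Ioi 0)).prod (volume.restrict (Ioi 0))).withDensity
      fun z : ℝ × ℝ => ENNReal.ofReal (p z.2 z.1) := by
  have hpm : Measurable fun z : ℝ × ℝ => ENNReal.ofReal (p z.2 z.1) :=
    (hp.measurable.comp measurable_swap).ennreal_ofReal
  refine Measure.ext_of_lintegral _ fun φ hφ => ?_
  rw [hS.lintegral_potentialMeasure hφ, lintegral_withDensity_eq_lintegral_mul _ hpm hφ,
    lintegral_prod_symm _ (hpm.mul hφ).aemeasurable]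
  refine setLIntegral_congr_fun measurableSet_Ioi fun r hr => ?_
  have hr : 0 < r := hr
  have h1 : ∫⁻ ω, φ (S r ω, r) ∂μ = ∫⁻ x, φ (x, r) ∂(μ.map (S r)) :=
    (lintegral_map (hφ.comp measurable_prodMk_right) (hS.measurable r hr.le)).symm
  simp only [h1, hp.law r hr]
  rw [lintegral_withDensity_eq_lintegral_mul _ (by
    exact hpm.comp measurable_prodMk_right) (by exact hφ.comp measurable_prodMk_right)]
  rfl

lemma HasBoundedDensities.ae_potentialMeasure_pos [SFinite μ] (hS : IsSubordinator S μ)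
    (hp : HasBoundedDensities S μ p) :
    ∀ᵐ z ∂(potentialMeasure S μ), 0 < z.1 ∧ 0 < z.2 := by
  rw [hp.potentialMeasure_eq hS]
  refine (withDensity_absolutelyContinuous _ _).ae_le ?_
  rw [Measure.prod_restrict]
  filter_upwards [ae_restrict_mem (measurableSet_Ioi.prod measurableSet_Ioi)] with z hz using hz

lemma IsDriftlessSubordinator.lintegral_expNeg [IsProbabilityMeasure μ]
    (hS : IsDriftlessSubordinator S ν μ) {l t : ℝ} (hl : 0 < l) (ht : 0 ≤ t) :
    ∫⁻ ω, ENNReal.ofReal (Real.exp (-(l * S t ω))) ∂μ =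
      ENNReal.ofReal (Real.exp (-(laplaceExponent ν l * t))) := by
  rw [mul_comm, ← hS.laplace l t hl ht, ofReal_integral_eq_lintegral_ofReal _
    (Eventually.of_forall fun ω => Real.exp_nonneg _)]
  refine Classical.by_contradiction fun h => ?_
  have h1 := hS.laplace l t hl ht
  rw [integral_undef h] at h1
  exact (Real.exp_pos _).ne h1

lemma IsDriftlessSubordinator.setLIntegral_expNeg_potentialMeasure [IsProbabilityMeasure μ]
    (hS : IsDriftlessSubordinator S ν μ) (hν : ν (Ioi 0) = ⊤) {l R : ℝ} (hl : 0 < l)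
    (hR : 0 ≤ R) :
    ∫⁻ z in {z : ℝ × ℝ | R < z.2}, ENNReal.ofReal (Real.exp (-(l * z.1))) ∂(potentialMeasure S μ) =
      ENNReal.ofReal (Real.exp (-(laplaceExponent ν l * R)) / laplaceExponent ν l) := by
  have hms : MeasurableSet {z : ℝ × ℝ | R < z.2} := measurableSet_lt measurable_const measurable_snd
  rw [← lintegral_indicator hms,
    hS.subordinator.lintegral_potentialMeasure (Measurable.indicator (by fun_prop) hms),
    ← lintegral_expNeg_Ioi (hS.levy.laplaceExponent_pos hν hl), ← lintegral_indicator
    measurableSet_Ioi, ← lintegral_indicator measurableSet_Ioi]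
  refine lintegral_congr fun r => ?_
  by_cases h : R < r
  · simp only [indicator, mem_Ioi, hR.trans_lt h, h, mem_ofPred_eq, if_true]
    exact hS.lintegral_expNeg hl (hR.trans h.le)
  · simp [indicator, h]

lemma IsDriftlessSubordinator.lintegral_expNeg_potentialMeasure [IsProbabilityMeasure μ]
    (hS : IsDriftlessSubordinator S ν μ) (hν : ν (Ioi 0) = ⊤) {l : ℝ} (hl : 0 < l) :
    ∫⁻ z, ENNReal.ofReal (Real.exp (-(l * z.1))) ∂(potentialMeasure S μ) =
      ENNReal.ofReal (1 / laplaceExponent ν l) := by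
  have h1 : ∀ᵐ z ∂(potentialMeasure S μ), 0 < z.2 := by
    refine (ae_map_iff hS.subordinator.aemeasurable_graph
      (measurableSet_lt measurable_const measurable_snd)).2 ?_
    exact Measure.quasiMeasurePreserving_snd.ae (ae_restrict_mem measurableSet_Ioi)
  have h2 := hS.setLIntegral_expNeg_potentialMeasure hν hl le_rfl
  rw [Measure.restrict_eq_self_of_ae_mem (s := {z : ℝ × ℝ | 0 < z.2}) h1] at h2
  simpa using h2

lemma IsDriftlessSubordinator.potentialMeasure_lt_top [IsProbabilityMeasure μ]
    (hS : IsDriftlessSubordinator S ν μ) (hν : ν (Ioi 0) = ⊤) (T : ℝ) :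
    potentialMeasure S μ {z | z.1 ≤ T} < ⊤ :=
  measure_Iic_lt_top_of_lintegral_expNeg
    (by rw [hS.lintegral_expNeg_potentialMeasure hν one_pos]; simp) measurable_fst T

end Potential

/-! ### Shifting the position of a space-time measure -/

section Shift

/-- The convolution of `W` with a space-time measure `m` in the position variable. -/
noncomputable def spaceConv (W : Measure ℝ) (m : Measure (ℝ × ℝ)) : Measure (ℝ × ℝ) :=
  (W.prod m).map fun q => (q.1 + q.2.1, q.2.2)

lemma measurable_spaceConv_map :
    Measurable fun q : ℝ × ℝ × ℝ => (q.1 + q.2.1, q.2.2) := by fun_prop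

instance (W : Measure ℝ) (m : Measure (ℝ × ℝ)) [SFinite W] [SFinite m] :
    SFinite (spaceConv W m) := by unfold spaceConv; infer_instance

lemma lintegral_spaceConv (W : Measure ℝ) (m : Measure (ℝ × ℝ)) [SFinite m]
    {φ : ℝ × ℝ → ENNReal} (hφ : Measurable φ) :
    ∫⁻ z, φ z ∂(spaceConv W m) = ∫⁻ y, ∫⁻ z, φ (y + z.1, z.2) ∂m ∂W := by
  rw [spaceConv, lintegral_map hφ measurable_spaceConv_map,
    lintegral_prod _ (by exact (hφ.comp measurable_spaceConv_map).aemeasurable)]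

lemma ae_spaceConv {W : Measure ℝ} {m : Measure (ℝ × ℝ)} [SFinite W] [SFinite m]
    (hW : ∀ᵐ y ∂W, 0 < y) (hm : ∀ᵐ z ∂m, 0 < z.1 ∧ 0 < z.2) :
    ∀ᵐ z ∂(spaceConv W m), 0 < z.1 ∧ 0 < z.2 := by
  refine (ae_map_iff measurable_spaceConv_map.aemeasurable
    ((measurableSet_lt measurable_const measurable_fst).inter
      (measurableSet_lt measurable_const measurable_snd))).2 ?_
  filter_upwards [Measure.quasiMeasurePreserving_fst.ae hW,
    Measure.quasiMeasurePreserving_snd.ae hm] with q h1 h2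
  exact ⟨add_pos h1 h2.1, h2.2⟩

variable {Ω : Type*} [MeasurableSpace Ω] {μ : Measure Ω} {S : ℝ → Ω → ℝ} {ν : Measure ℝ}
  {p : ℝ → ℝ → ℝ}

/-- With `q = w * p` the density of the law of the inverse subordinator, the part of
`q r x dx dr` with `r > R` has marginal `P (S_R ≤ x) dx`. Both sides have Laplace transform
`exp (-R φ(l)) / l`. -/
lemma IsDriftlessSubordinator.map_fst_restrict_spaceConv [IsProbabilityMeasure μ]
    (hS : IsDriftlessSubordinator S ν μ) (hν : ν (Ioi 0) = ⊤) {R : ℝ} (hR : 0 ≤ R) :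
    ((spaceConv (tailMeasure ν) (potentialMeasure S μ)).restrict {z | R < z.2}).map Prod.fst =
      (volume.restrict (Ioi 0)).conv (μ.map (S R)) := by
  have hms : MeasurableSet {z : ℝ × ℝ | R < z.2} := measurableSet_lt measurable_const measurable_snd
  have hmul : ∀ l x y : ℝ, ENNReal.ofReal (Real.exp (-(l * (x + y)))) =
      ENNReal.ofReal (Real.exp (-(l * x))) * ENNReal.ofReal (Real.exp (-(l * y))) := by
    intro l x y
    rw [← ENNReal.ofReal_mul (Real.exp_nonneg _), ← Real.exp_add]
    ring_nf
  have hL : ∀ l : ℝ, 0 < l → ∫⁻ x, ENNReal.ofReal (Real.exp (-(l * x)))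
      ∂(((spaceConv (tailMeasure ν) (potentialMeasure S μ)).restrict {z | R < z.2}).map Prod.fst) =
      ENNReal.ofReal (Real.exp (-(laplaceExponent ν l * R)) / l) := by
    intro l hl
    have hφ := hS.levy.laplaceExponent_pos hν hl
    rw [lintegral_map (measurable_expNeg l) measurable_fst, ← lintegral_indicator hms,
      lintegral_spaceConv _ _ (Measurable.indicator (by fun_prop) hms)]
    have h1 : ∀ y : ℝ, ∫⁻ z, {z : ℝ × ℝ | R < z.2}.indicator
        (fun z => ENNReal.ofReal (Real.exp (-(l * z.1)))) (y + z.1, z.2) ∂(potentialMeasure S μ) =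
        ENNReal.ofReal (Real.exp (-(l * y))) *
        ENNReal.ofReal (Real.exp (-(laplaceExponent ν l * R)) / laplaceExponent ν l) := by
      intro y
      rw [← hS.setLIntegral_expNeg_potentialMeasure hν hl hR, ← lintegral_indicator hms,
        ← lintegral_const_mul _ (Measurable.indicator (by fun_prop) hms)]
      refine lintegral_congr fun z => ?_
      by_cases h : R < z.2 <;> simp [indicator, h, hmul]
    simp_rw [h1]
    rw [lintegral_mul_const _ (measurable_expNeg l), hS.levy.lintegral_expNeg_tailMeasure hl,
      ← ENNReal.ofReal_mul (by positivity)]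
    congr 1
    field_simp
  have hRt : ∀ l : ℝ, 0 < l → ∫⁻ x, ENNReal.ofReal (Real.exp (-(l * x)))
      ∂((volume.restrict (Ioi 0)).conv (μ.map (S R))) =
      ENNReal.ofReal (Real.exp (-(laplaceExponent ν l * R)) / l) := by
    intro l hl
    rw [Measure.lintegral_conv (measurable_expNeg l)]
    simp_rw [hmul]
    have h1 : ∀ x : ℝ, ∫⁻ y, ENNReal.ofReal (Real.exp (-(l * x))) *
        ENNReal.ofReal (Real.exp (-(l * y))) ∂(μ.map (S R)) =
        ENNReal.ofReal (Real.exp (-(l * x))) *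
        ENNReal.ofReal (Real.exp (-(laplaceExponent ν l * R))) := by
      intro x
      rw [lintegral_const_mul _ (measurable_expNeg l), lintegral_map (measurable_expNeg l)
        (hS.subordinator.measurable R hR), hS.lintegral_expNeg hl hR]
    simp_rw [h1]
    rw [lintegral_mul_const _ (measurable_expNeg l), lintegral_expNeg_Ioi hl, ← ENNReal.ofReal_mul
      (by positivity)]
    congr 1
    simp
    ring
  refine ext_of_lintegral_expNeg (fun l hl => ?_) fun l hl => ?_
  · rw [hL l hl]; simp
  · rw [hL l hl, hRt l hl]

/-- The measures `q r x dr`, the laws of the inverse subordinator, have total mass one for almost every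
position `x`. -/
lemma IsDriftlessSubordinator.map_fst_spaceConv [IsProbabilityMeasure μ]
    (hS : IsDriftlessSubordinator S ν μ) (hν : ν (Ioi 0) = ⊤) (hp : HasBoundedDensities S μ p) :
    (spaceConv (tailMeasure ν) (potentialMeasure S μ)).map Prod.fst =
      volume.restrict (Ioi 0) := by
  have h1 : ∀ᵐ z ∂(spaceConv (tailMeasure ν) (potentialMeasure S μ)), 0 < z.2 :=
    (ae_spaceConv (ae_tailMeasure_pos ν) (hp.ae_potentialMeasure_pos hS.subordinator)).mono
      fun z hz => hz.2
  have h2 := hS.map_fst_restrict_spaceConv hν le_rfl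
  rw [Measure.restrict_eq_self_of_ae_mem (s := {z : ℝ × ℝ | 0 < z.2}) h1] at h2
  rw [h2, Measure.map_congr hS.subordinator.zero, Measure.map_const]
  simp

/-- Integrating `q` over times larger than `r` gives `P (S_r ≤ x)`; as a statement on measures, the
potential measure convolved with Lebesgue measure is the image of
`{(x, ρ, r) | 0 < r < ρ}` with weight `q ρ x dx dρ dr` under `(x, ρ, r) ↦ (x, r)`. -/
lemma IsDriftlessSubordinator.spaceConv_volume [IsProbabilityMeasure μ]
    (hS : IsDriftlessSubordinator S ν μ) (hν : ν (Ioi 0) = ⊤) :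
    spaceConv (volume.restrict (Ioi 0)) (potentialMeasure S μ) =
      (((spaceConv (tailMeasure ν) (potentialMeasure S μ)).prod (volume.restrict (Ioi 0))).restrict
        {q | q.2 < q.1.2}).map fun q => (q.1.1, q.2) := by
  have hms : MeasurableSet {q : (ℝ × ℝ) × ℝ | q.2 < q.1.2} :=
    measurableSet_lt measurable_snd (measurable_snd.comp measurable_fst)
  have hmap : Measurable fun q : (ℝ × ℝ) × ℝ => (q.1.1, q.2) := by fun_prop
  refine Measure.ext_of_lintegral _ fun φ hφ => ?_
  rw [lintegral_spaceConv _ _ hφ, lintegral_map hφ hmap, ← lintegral_indicator hms,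
    lintegral_prod_symm _ (by exact (Measurable.indicator (hφ.comp hmap) hms).aemeasurable)]
  rw [lintegral_lintegral_swap (Measurable.aemeasurable (by fun_prop)),
    hS.subordinator.lintegral_potentialMeasure (Measurable.lintegral_prod_left (by fun_prop))]
  refine setLIntegral_congr_fun measurableSet_Ioi fun r hr => ?_
  have hr : 0 < r := hr
  have h1 : Measurable fun x : ℝ => ∫⁻ y in Ioi 0, φ (x + y, r) :=
    Measurable.lintegral_prod_right (f := fun x y => φ (x + y, r)) (by fun_prop)
  have h2 := Measure.lintegral_conv (μ := μ.map (S r)) (ν := volume.restrict (Ioi 0))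
    (f := fun x => φ (x, r)) (by fun_prop)
  rw [Measure.conv_comm, ← hS.map_fst_restrict_spaceConv hν hr.le,
    lintegral_map (by fun_prop) measurable_fst, ← lintegral_indicator
    (measurableSet_lt measurable_const measurable_snd)] at h2
  have h3 : ∀ y x : ℝ, φ (y + x, r) = φ (x + y, r) := fun y x => by rw [add_comm]
  simp only [h3 _ (S r _)]
  rw [lintegral_map h1 (hS.subordinator.measurable r hr.le)] at h2
  rw [← h2]
  refine lintegral_congr fun z => ?_
  by_cases h : r < z.2 <;> simp [indicator, h]

end Shift

/-! ### Operator-valued convolutions in time -/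

section TimeConv

variable {B : Type*} [NormedAddCommGroup B] {F H : ℝ → B}

lemma integrable_of_norm_le_of_ae_notMem {α : Type*} [MeasurableSpace α] {m : Measure α}
    {f : α → B} {s : Set α} {C : ℝ} (hf : AEStronglyMeasurable f m) (hs : m s < ⊤)
    (hC : ∀ᵐ a ∂m, ‖f a‖ ≤ C) (h0 : ∀ᵐ a ∂m, a ∉ s → f a = 0) : Integrable f m :=
  IntegrableOn.integrable_of_ae_notMem_eq_zero
    (Measure.integrableOn_of_bounded hs.ne hf (ae_restrict_of_ae hC)) h0

lemma integrable_comp_sub {β : Type*} [MeasurableSpace β] {m : Measure β} [IsFiniteMeasure m]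
    {X : β → ℝ} (hX : Measurable X) (hF : StronglyMeasurable F) (hFi : Integrable F) :
    Integrable (fun q : ℝ × β => F (q.1 - X q.2)) (volume.prod m) := by
  rw [integrable_prod_iff' (by exact (hF.comp_measurable (by fun_prop)).aestronglyMeasurable)]
  refine ⟨Eventually.of_forall fun z => by exact hFi.comp_sub_right (X z), ?_⟩
  simp only [integral_sub_right_eq_self (fun x => ‖F x‖)]
  exact integrable_const _

variable [NormedSpace ℝ B] {P : ℝ → B →L[ℝ] B} {m : Measure (ℝ × ℝ)}

/-- The convolution `t ↦ ∫ P_r F(t - x) m(dx, dr)` of a function with a space-time measure through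
the semigroup; the position variable `x` of `m` is the time variable of the equation. -/
noncomputable def timeConv (P : ℝ → B →L[ℝ] B) (m : Measure (ℝ × ℝ)) (F : ℝ → B) (t : ℝ) : B :=
  ∫ z, P z.2 (F (t - z.1)) ∂m

lemma IsBoundedC0Semigroup.aestronglyMeasurable_comp (hP : IsBoundedC0Semigroup P)
    {α : Type*} [MeasurableSpace α] {m : Measure α} {X τ : α → ℝ} (hF : StronglyMeasurable F)
    (hX : Measurable X) (hτ : Measurable τ) (h0 : ∀ᵐ a ∂m, 0 ≤ τ a) :
    AEStronglyMeasurable (fun a => P (τ a) (F (X a))) m :=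
  hP.aestronglyMeasurable_apply hτ.aemeasurable (hF.comp_measurable hX).aestronglyMeasurable h0

lemma integrable_timeConv_of_bounded (hP : IsBoundedC0Semigroup P)
    (hm : ∀ᵐ z ∂m, 0 < z.1 ∧ 0 < z.2) (hmT : ∀ T, m {z | z.1 ≤ T} < ⊤)
    (hF : StronglyMeasurable F) {K : ℝ} (hK : ∀ t, ‖F t‖ ≤ K) (hF0 : ∀ t ≤ 0, F t = 0) (t : ℝ) :
    Integrable (fun z => P z.2 (F (t - z.1))) m := by
  obtain ⟨M, hM0, hM⟩ := hP.exists_bound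
  refine integrable_of_norm_le_of_ae_notMem (C := M * K) (hP.aestronglyMeasurable_comp hF
    (by fun_prop) (by fun_prop) (hm.mono fun z hz => hz.2.le)) (hmT t) ?_ ?_
  · filter_upwards [hm] with z hz
    exact (hM _ hz.2.le _).trans (mul_le_mul_of_nonneg_left (hK _) hM0)
  · refine Eventually.of_forall fun z hz => ?_
    rw [hF0 _ (by simp at hz; linarith), map_zero]

/-- Integrability in all variables of the iterated convolution of `W`, `m` and a bounded `F`. -/
lemma integrable_prod_of_bounded [SFinite m] (hP : IsBoundedC0Semigroup P)
    (hm : ∀ᵐ z ∂m, 0 < z.1 ∧ 0 < z.2) (hmT : ∀ T, m {z | z.1 ≤ T} < ⊤)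
    {W : Measure ℝ} [SFinite W] (hW : ∀ᵐ y ∂W, 0 < y) (hWT : ∀ T, W (Iic T) < ⊤)
    (hF : StronglyMeasurable F) {K : ℝ} (hK : ∀ t, ‖F t‖ ≤ K) (hF0 : ∀ t ≤ 0, F t = 0) (t : ℝ) :
    Integrable (fun q : ℝ × ℝ × ℝ => P q.2.2 (F (t - q.1 - q.2.1))) (W.prod m) := by
  obtain ⟨M, hM0, hM⟩ := hP.exists_bound
  have hm' := Measure.quasiMeasurePreserving_snd (μ := W).ae hm
  have hW' := Measure.quasiMeasurePreserving_fst (ν := m).ae hW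
  refine integrable_of_norm_le_of_ae_notMem (C := M * K) (s := Iic t ×ˢ {z | z.1 ≤ t})
    (hP.aestronglyMeasurable_comp hF (by fun_prop) (by fun_prop)
      (hm'.mono fun z hz => hz.2.le)) ?_ ?_ ?_
  · rw [Measure.prod_prod]
    exact ENNReal.mul_lt_top (hWT t) (hmT t)
  · filter_upwards [hm'] with z hz
    exact (hM _ hz.2.le _).trans (mul_le_mul_of_nonneg_left (hK _) hM0)
  · filter_upwards [hm', hW'] with q h1 h2 hq
    have h3 : t - q.1 - q.2.1 ≤ 0 := by
      simp only [mem_prod, mem_Iic, mem_ofPred_eq, not_and_or, not_le] at hq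
      rcases hq with h | h <;> linarith [h1.1]
    rw [hF0 _ h3, map_zero]

/-- Joint integrability of the integrand of `timeConv` on bounded time intervals. -/
lemma integrable_timeConv_prod [SFinite m] (hP : IsBoundedC0Semigroup P)
    (hm : ∀ᵐ z ∂m, 0 < z.1 ∧ 0 < z.2) (hmT : ∀ T, m {z | z.1 ≤ T} < ⊤)
    (hF : StronglyMeasurable F) (hFi : Integrable F) (hF0 : ∀ t ≤ 0, F t = 0) (T : ℝ) :
    Integrable (fun q : ℝ × ℝ × ℝ => P q.2.2 (F (q.1 - q.2.1)))
      ((volume.restrict (Iic T)).prod m) := by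
  have hm' := Measure.quasiMeasurePreserving_snd (μ := volume.restrict (Iic T)).ae hm
  have hT := Measure.quasiMeasurePreserving_fst (ν := m).ae
    (ae_restrict_mem (μ := volume) (measurableSet_Iic (a := T)))
  refine hP.integrable_apply (by fun_prop) ?_ (hm'.mono fun z hz => hz.2.le)
  refine IntegrableOn.integrable_of_ae_notMem_eq_zero (s := univ ×ˢ {z | z.1 ≤ T}) ?_ ?_
  · have : IsFiniteMeasure (m.restrict {z | z.1 ≤ T}) := ⟨by simpa using hmT T⟩
    rw [IntegrableOn, ← Measure.prod_restrict, Measure.restrict_univ]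
    exact (integrable_comp_sub measurable_fst hF hFi).mono_measure
      (Measure.prod_mono Measure.restrict_le_self le_rfl)
  · filter_upwards [hT] with q hq hz
    refine hF0 _ ?_
    simp at hz hq
    linarith

/-- The iterated convolution of Lebesgue measure on `(0, ∞)`, `m` and an integrable `F` converges
absolutely at every time. -/
lemma integrable_prod_of_integrable [SFinite m] (hP : IsBoundedC0Semigroup P)
    (hm : ∀ᵐ z ∂m, 0 < z.1 ∧ 0 < z.2) (hmT : ∀ T, m {z | z.1 ≤ T} < ⊤)
    (hF : StronglyMeasurable F) (hFi : Integrable F) (hF0 : ∀ t ≤ 0, F t = 0) (t : ℝ) :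
    Integrable (fun q : ℝ × ℝ × ℝ => P q.2.2 (F (t - q.1 - q.2.1)))
      ((volume.restrict (Ioi 0)).prod m) := by
  have h1 := integrable_timeConv_prod hP hm hmT hF hFi hF0 t
  have h2 : MeasurePreserving (fun y : ℝ => t - y) (volume.restrict (Ioi 0))
      (volume.restrict (Iio t)) := by
    have := (Measure.measurePreserving_sub_left volume t).restrict_preimage
      (measurableSet_Iio (a := t))
    simpa using this
  have h3 := h2.prod (MeasurePreserving.id m)
  exact h3.integrable_comp_of_integrable
    (h1.mono_measure (Measure.prod_mono (Measure.restrict_mono Iio_subset_Iic_self le_rfl) le_rfl))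

variable {W : Measure ℝ}

lemma timeConv_spaceConv (hP : IsBoundedC0Semigroup P) (hm : ∀ᵐ z ∂m, 0 < z.1 ∧ 0 < z.2)
    (hF : StronglyMeasurable F) (t : ℝ) : timeConv P (spaceConv W m) F t =
      ∫ q, P q.2.2 (F (t - q.1 - q.2.1)) ∂(W.prod m) := by
  have h0 : ∀ᵐ z ∂(spaceConv W m), 0 < z.2 := by
    refine (ae_map_iff measurable_spaceConv_map.aemeasurable
      (measurableSet_lt measurable_const measurable_snd)).2 ?_
    exact (Measure.quasiMeasurePreserving_snd.ae hm).mono fun q hq => hq.2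
  rw [timeConv, spaceConv, integral_map measurable_spaceConv_map.aemeasurable]
  · simp_rw [sub_sub]
  · exact hP.aestronglyMeasurable_comp hF (by fun_prop) (by fun_prop) (h0.mono fun z hz => hz.le)

variable [SFinite W] [SFinite m]

lemma integral_timeConv_sub (hP : IsBoundedC0Semigroup P) (hm : ∀ᵐ z ∂m, 0 < z.1 ∧ 0 < z.2)
    (hF : StronglyMeasurable F) (t : ℝ)
    (h : Integrable (fun q : ℝ × ℝ × ℝ => P q.2.2 (F (t - q.1 - q.2.1))) (W.prod m)) :
    ∫ y, timeConv P m F (t - y) ∂W = timeConv P (spaceConv W m) F t := by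
  rw [timeConv_spaceConv hP hm hF, integral_prod _ h]
  rfl

lemma timeConv_integral_sub [CompleteSpace B] (hP : IsBoundedC0Semigroup P)
    (hm : ∀ᵐ z ∂m, 0 < z.1 ∧ 0 < z.2) (hF : StronglyMeasurable F) (t : ℝ)
    (h : Integrable (fun q : ℝ × ℝ × ℝ => P q.2.2 (F (t - q.1 - q.2.1))) (W.prod m))
    (hW : ∀ s, Integrable (fun y => F (s - y)) W) :
    timeConv P m (fun s => ∫ y, F (s - y) ∂W) t = timeConv P (spaceConv W m) F t := by
  rw [timeConv_spaceConv hP hm hF, integral_prod_symm _ h]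
  refine integral_congr_ae (Eventually.of_forall fun z => ?_)
  simp only
  rw [← ContinuousLinearMap.integral_comp_comm _ (hW _)]
  simp_rw [sub_right_comm]

variable [CompleteSpace B] {H' : ℝ → B} {Q G : Measure (ℝ × ℝ)} [SFinite Q]

/-- If `Q(dx, dρ) = q_x(dρ) dx` with probability measures `q_x` and `G(dx, dr) = q_x(r, ∞) dx dr`,
then integrating `P_ρ h - h = ∫_0^ρ P_r L h dr` against `Q` gives an integral against `G`. -/
lemma integral_apply_eq_add (hP : IsBoundedC0Semigroup P) (hQ : ∀ᵐ z ∂Q, 0 < z.1 ∧ 0 < z.2)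
    (hfst : Q.map Prod.fst = volume.restrict (Ioi 0))
    (hG : G = ((Q.prod (volume.restrict (Ioi 0))).restrict {q | q.2 < q.1.2}).map
      fun q => (q.1.1, q.2))
    (hH : StronglyMeasurable H) (hHi : IntegrableOn H (Ioi 0))
    (hH'i : Integrable (fun z => P z.2 (H' z.1)) G) (hgen : ∀ x, HasGenAt P (H x) (H' x)) :
    ∫ z, P z.2 (H z.1) ∂Q = (∫ x in Ioi 0, H x) + ∫ z, P z.2 (H' z.1) ∂G := by
  have hms : MeasurableSet {q : (ℝ × ℝ) × ℝ | q.2 < q.1.2} :=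
    measurableSet_lt measurable_snd (measurable_snd.comp measurable_fst)
  have hmap : Measurable fun q : (ℝ × ℝ) × ℝ => (q.1.1, q.2) := by fun_prop
  have h1 : Integrable (fun z : ℝ × ℝ => H z.1) Q := by
    have : Integrable H (Q.map Prod.fst) := by rw [hfst]; exact hHi
    exact this.comp_measurable measurable_fst
  have h2 : Integrable (fun z : ℝ × ℝ => P z.2 (H z.1)) Q :=
    hP.integrable_apply (by fun_prop) h1 (hQ.mono fun z hz => hz.2.le)
  have h3 : ∫ x in Ioi 0, H x = ∫ z, H z.1 ∂Q := by
    rw [← hfst, integral_map measurable_fst.aemeasurable hH.aestronglyMeasurable]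
  have h4 : Integrable (fun q : (ℝ × ℝ) × ℝ => {q : (ℝ × ℝ) × ℝ | q.2 < q.1.2}.indicator
      (fun q => P q.2 (H' q.1.1)) q) (Q.prod (volume.restrict (Ioi 0))) := by
    rw [hG] at hH'i
    exact (integrable_indicator_iff hms).2 (hH'i.comp_measurable hmap)
  have h5 : ∫ z, P z.2 (H' z.1) ∂G = ∫ z, (∫ r in Ioi 0, {q : (ℝ × ℝ) × ℝ | q.2 < q.1.2}.indicator
      (fun q => P q.2 (H' q.1.1)) (z, r)) ∂Q := by
    rw [← integral_prod _ h4, integral_indicator hms, hG, integral_map hmap.aemeasurable]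
    exact hG ▸ hH'i.1
  rw [h3, h5, ← sub_eq_iff_eq_add', ← integral_sub h2 h1]
  refine integral_congr_ae ?_
  filter_upwards [hQ] with z hz
  rw [← (hgen z.1).integral_apply hP hz.2.le, integral_Ioc_eq_integral_Ioo,
    ← integral_indicator measurableSet_Ioo, ← integral_indicator measurableSet_Ioi]
  congr 1
  ext r
  simp only [indicator, mem_Ioo, mem_Ioi, mem_ofPred_eq]
  split_ifs <;> simp_all

end TimeConv

/-! ### Continuity of the convolution with the potential measure -/

section Continuity

variable {B : Type*} [NormedAddCommGroup B] {F : ℝ → B}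

/-- Translations are continuous in `L¹`. -/
lemma tendsto_integral_norm_translate_sub (hF : Integrable F) :
    Tendsto (fun h : ℝ => ∫ x, ‖F (h + x) - F x‖) (𝓝 0) (𝓝 0) := by
  have : Fact ((1 : ENNReal) ≠ ⊤) := ⟨ENNReal.one_ne_top⟩
  have hL := memLp_one_iff_integrable.2 hF
  have h1 : Continuous fun h : ℝ => DomAddAct.mk h +ᵥ hL.toLp F :=
    DomAddAct.continuous_mk.vadd (continuous_const (y := hL.toLp F))
  have h2 : Continuous fun h : ℝ => ‖(DomAddAct.mk h +ᵥ hL.toLp F) - hL.toLp F‖ :=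
    (h1.sub continuous_const).norm
  have h3 := h2.tendsto 0
  have h4 : ∀ h : ℝ, ‖(DomAddAct.mk h +ᵥ hL.toLp F) - hL.toLp F‖ = ∫ x, ‖F (h + x) - F x‖ := by
    intro h
    rw [L1.norm_eq_integral_norm]
    refine integral_congr_ae ?_
    have h5 := hL.comp_measurePreserving (measurePreserving_vadd h (volume : Measure ℝ))
    filter_upwards [Lp.coeFn_sub (DomAddAct.mk h +ᵥ hL.toLp F) (hL.toLp F), hL.coeFn_toLp,
      h5.coeFn_toLp] with x h6 h7 h8
    rw [h6, Pi.sub_apply, h7]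
    erw [h8]
    rfl
  simp_rw [h4] at h3
  simpa using h3

variable {Ω : Type*} [MeasurableSpace Ω] {μ : Measure Ω} {S : ℝ → Ω → ℝ} {ν : Measure ℝ}
  {p : ℝ → ℝ → ℝ}

lemma integrable_prod_of_potentialMeasure [SFinite μ] {f : ℝ × ℝ → B} (hS : IsSubordinator S μ)
    (h : Integrable f (potentialMeasure S μ)) :
    Integrable (fun q : Ω × ℝ => f (S q.2 q.1, q.2)) (μ.prod (volume.restrict (Ioi 0))) :=
  Integrable.comp_aemeasurable h hS.aemeasurable_graph

variable [NormedSpace ℝ B] {P : ℝ → B →L[ℝ] B}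

lemma HasBoundedDensities.exists_map_le (hp : HasBoundedDensities S μ p) {r : ℝ} (hr : 0 < r) :
    ∃ C : ℝ, 0 ≤ C ∧ μ.map (S r) ≤ ENNReal.ofReal C • volume := by
  obtain ⟨C, hC⟩ := hp.bounded r hr
  refine ⟨max C 0, le_max_right _ _, ?_⟩
  rw [hp.law r hr, ← withDensity_const]
  refine (withDensity_mono (μ := volume.restrict (Ioi 0)) (g := fun _ => ENNReal.ofReal (max C 0))
    ?_).trans ?_
  · filter_upwards [ae_restrict_mem measurableSet_Ioi] with x hx
    exact ENNReal.ofReal_le_ofReal ((hC x hx).trans (le_max_left _ _))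
  · rw [withDensity_const, withDensity_const]
    gcongr
    exact Measure.restrict_le_self

/-- The convolution of an integrable function with the bounded density of `S r` is continuous. -/
lemma continuous_integral_apply_sub [IsProbabilityMeasure μ] (hP : IsBoundedC0Semigroup P)
    (hS : IsSubordinator S μ) (hp : HasBoundedDensities S μ p) (hF : StronglyMeasurable F)
    (hFi : Integrable F) {K : ℝ} (hK : ∀ t, ‖F t‖ ≤ K) {r : ℝ} (hr : 0 < r) :
    Continuous fun t => ∫ ω, P r (F (t - S r ω)) ∂μ := by
  obtain ⟨M, hM0, hM⟩ := hP.exists_bound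
  obtain ⟨C, hC0, hC⟩ := hp.exists_map_le hr
  have hSm := hS.measurable r hr.le
  have hFint : ∀ t, Integrable (fun ω => F (t - S r ω)) μ := fun t =>
    Integrable.of_bound (hF.comp_measurable (by fun_prop)).aestronglyMeasurable K
      (Eventually.of_forall fun ω => hK _)
  rw [continuous_iff_continuousAt]
  intro t₀
  rw [ContinuousAt, tendsto_iff_norm_sub_tendsto_zero]
  have h1 : Tendsto (fun t : ℝ => M * (C * ∫ x, ‖F ((t - t₀) + x) - F x‖)) (𝓝 t₀) (𝓝 0) := by
    have h2 : Tendsto (fun t : ℝ => t - t₀) (𝓝 t₀) (𝓝 0) := by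
      simpa using (continuous_sub_right t₀).tendsto t₀
    simpa using (((tendsto_integral_norm_translate_sub hFi).comp h2).const_mul C).const_mul M
  refine squeeze_zero (fun _ => norm_nonneg _) (fun t => ?_) h1
  have h3 : ∫ ω, ‖F (t - S r ω) - F (t₀ - S r ω)‖ ∂μ ≤ C * ∫ x, ‖F ((t - t₀) + x) - F x‖ := by
    have h4 : StronglyMeasurable fun x => ‖F (t - x) - F (t₀ - x)‖ :=
      ((hF.comp_measurable (by fun_prop)).sub (hF.comp_measurable (by fun_prop))).norm
    have h5 : Integrable fun x => ‖F (t - x) - F (t₀ - x)‖ :=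
      ((hFi.comp_sub_left t).sub (hFi.comp_sub_left t₀)).norm
    have h6 : ∫ x, ‖F (t - x) - F (t₀ - x)‖ = ∫ x, ‖F ((t - t₀) + x) - F x‖ := by
      rw [← integral_sub_left_eq_self (fun x => ‖F ((t - t₀) + x) - F x‖) volume t₀]
      congr 1
      ext x
      congr 3
      ring
    rw [← integral_map (f := fun x => ‖F (t - x) - F (t₀ - x)‖) hSm.aemeasurable
      h4.aestronglyMeasurable, ← h6]
    refine (integral_mono_measure hC (Eventually.of_forall fun x => norm_nonneg _)
      (h5.smul_measure ENNReal.ofReal_ne_top)).trans ?_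
    rw [integral_smul_measure, ENNReal.toReal_ofReal hC0, smul_eq_mul]
  rw [← integral_sub ((P r).integrable_comp (hFint t)) ((P r).integrable_comp (hFint t₀))]
  refine (norm_integral_le_integral_norm _).trans ((?_ : _ ≤ M * _).trans
    (mul_le_mul_of_nonneg_left h3 hM0))
  rw [← integral_const_mul]
  refine integral_mono_of_nonneg (Eventually.of_forall fun ω => norm_nonneg _)
    (((hFint t).sub (hFint t₀)).norm.const_mul M) (Eventually.of_forall fun ω => ?_)
  simp only
  rw [← map_sub]
  exact hM r hr.le _

lemma integral_potentialMeasure [SFinite μ] {f : ℝ × ℝ → B} (hS : IsSubordinator S μ)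
    (h : Integrable f (potentialMeasure S μ)) :
    ∫ z, f z ∂(potentialMeasure S μ) =
      ∫ q : Ω × ℝ, f (S q.2 q.1, q.2) ∂(μ.prod (volume.restrict (Ioi 0))) :=
  integral_map hS.aemeasurable_graph h.1

lemma continuous_timeConv_potentialMeasure [IsProbabilityMeasure μ]
    (hP : IsBoundedC0Semigroup P) (hS : IsDriftlessSubordinator S ν μ) (hν : ν (Ioi 0) = ⊤)
    (hp : HasBoundedDensities S μ p) (hF : StronglyMeasurable F) (hFi : Integrable F) {K : ℝ}
    (hK : ∀ t, ‖F t‖ ≤ K) (hF0 : ∀ t ≤ 0, F t = 0) :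
    Continuous (timeConv P (potentialMeasure S μ) F) := by
  obtain ⟨M, hM0, hM⟩ := hP.exists_bound
  have hs := hS.subordinator
  have hm := hp.ae_potentialMeasure_pos hs
  have hmT := hS.potentialMeasure_lt_top hν
  have hi := integrable_timeConv_of_bounded hP hm hmT hF hK hF0
  have h1 : timeConv P (potentialMeasure S μ) F =
      fun t => ∫ r in Ioi 0, ∫ ω, P r (F (t - S r ω)) ∂μ := by
    ext t
    rw [timeConv, integral_potentialMeasure hs (hi t),
      integral_prod_symm _ (integrable_prod_of_potentialMeasure hs (hi t))]
  rw [h1, continuous_iff_continuousAt]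
  intro t₀
  have hb : Integrable (fun z : ℝ × ℝ => (Iic (t₀ + 1)).indicator (fun _ => M * K) z.1)
      (potentialMeasure S μ) := by
    have : (fun z : ℝ × ℝ => (Iic (t₀ + 1)).indicator (fun _ => M * K) z.1) =
        {z : ℝ × ℝ | z.1 ≤ t₀ + 1}.indicator fun _ => M * K := by
      ext z
      simp [indicator]
    rw [this, integrable_indicator_iff (measurableSet_le measurable_fst measurable_const)]
    exact integrableOn_const (hmT _).ne
  have hb' := integrable_prod_of_potentialMeasure hs hb
  refine continuousAt_of_dominated
    (bound := fun r => ∫ ω, (Iic (t₀ + 1)).indicator (fun _ => M * K) (S r ω) ∂μ) ?_ ?_ ?_ ?_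
  · exact Eventually.of_forall fun t =>
      (integrable_prod_of_potentialMeasure hs (hi t)).integral_prod_right.1
  · filter_upwards [Iio_mem_nhds (lt_add_one t₀)] with t ht
    have ht : t < t₀ + 1 := ht
    filter_upwards [hb'.prod_left_ae, ae_restrict_mem measurableSet_Ioi] with r hr hr0
    refine norm_integral_le_of_norm_le hr (Eventually.of_forall fun ω => ?_)
    have hr0 : 0 < r := hr0
    by_cases h : S r ω ≤ t₀ + 1
    · simp only [indicator, mem_Iic, h, if_true]
      exact (hM r hr0.le _).trans (mul_le_mul_of_nonneg_left (hK _) hM0)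
    · have h0 : F (t - S r ω) = 0 := hF0 _ (by linarith)
      simp [h0, h]
  · exact hb'.integral_prod_right
  · filter_upwards [ae_restrict_mem measurableSet_Ioi] with r hr
    exact (continuous_integral_apply_sub hP hs hp hF hFi hK hr).continuousAt

lemma timeConv_potentialMeasure_of_nonpos [SFinite μ] (hS : IsSubordinator S μ)
    (hp : HasBoundedDensities S μ p) (hF0 : ∀ t ≤ 0, F t = 0) {t : ℝ} (ht : t ≤ 0) :
    timeConv P (potentialMeasure S μ) F t = 0 := by
  refine integral_eq_zero_of_ae ?_
  filter_upwards [hp.ae_potentialMeasure_pos hS] with z hz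
  rw [hF0 _ (by linarith [hz.1]), map_zero, Pi.zero_apply]

end Continuity

/-! ### Regular versions of inhomogeneities -/

section Regular

variable {B : Type*} [NormedAddCommGroup B] [NormedSpace ℝ B] {P : ℝ → B →L[ℝ] B}

/-- `F` is a strongly measurable function, bounded by `K` and supported in `(0, T₀]`, all of whose
values lie in the domain of the generator, with `H = L F` strongly measurable and integrable. -/
structure IsRegular (P : ℝ → B →L[ℝ] B) (T₀ K : ℝ) (F H : ℝ → B) : Prop where
  stronglyMeasurable : StronglyMeasurable F
  stronglyMeasurable_gen : StronglyMeasurable H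
  hasGenAt : ∀ t, HasGenAt P (F t) (H t)
  eq_zero : ∀ t, t ∉ Ioc 0 T₀ → F t = 0
  gen_eq_zero : ∀ t, t ∉ Ioc 0 T₀ → H t = 0
  norm_le : ∀ t, ‖F t‖ ≤ K
  integrable : Integrable F
  integrable_gen : Integrable H

/-- A function on `(0, T₀]` with values in the domain of the generator can be modified on a null set
so that all its properties hold everywhere. -/
lemma exists_isRegular {T₀ K : ℝ} (hK0 : 0 ≤ K) {f h : ℝ → B}
    (hf : AEStronglyMeasurable f (volume.restrict (Ioc 0 T₀)))
    (hh : IntegrableOn h (Ioc 0 T₀))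
    (hgen : ∀ᵐ t ∂(volume.restrict (Ioc 0 T₀)), HasGenAt P (f t) (h t))
    (hK : ∀ᵐ t ∂(volume.restrict (Ioc 0 T₀)), ‖f t‖ ≤ K) :
    ∃ F H : ℝ → B, IsRegular P T₀ K F H ∧ F =ᵐ[volume.restrict (Ioc 0 T₀)] f ∧
      H =ᵐ[volume.restrict (Ioc 0 T₀)] h := by
  have hgood : ∀ᵐ t ∂(volume.restrict (Ioc 0 T₀)), hf.mk f t = f t ∧ hh.1.mk h t = h t ∧
      HasGenAt P (hf.mk f t) (hh.1.mk h t) ∧ ‖hf.mk f t‖ ≤ K := by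
    filter_upwards [hgen, hK, hf.ae_eq_mk, hh.1.ae_eq_mk] with t h1 h2 h3 h4
    rw [← h3, ← h4]
    exact ⟨rfl, rfl, h1, h2⟩
  obtain ⟨s, hs, hsm, hs0⟩ := hgood.exists_measurable_mem
  set A := Ioc 0 T₀ ∩ s with hA
  have hAm : MeasurableSet A := measurableSet_Ioc.inter hsm
  have hAe : ∀ᵐ t ∂(volume.restrict (Ioc 0 T₀)), t ∈ A := by
    filter_upwards [ae_restrict_mem measurableSet_Ioc, hs] with t h1 h2 using ⟨h1, h2⟩
  have hFm : StronglyMeasurable (A.indicator (hf.mk f)) := hf.stronglyMeasurable_mk.indicator hAm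
  have hHm : StronglyMeasurable (A.indicator (hh.1.mk h)) :=
    hh.1.stronglyMeasurable_mk.indicator hAm
  have hFK : ∀ t, ‖A.indicator (hf.mk f) t‖ ≤ K := by
    intro t
    by_cases ht : t ∈ A
    · rw [indicator_of_mem ht]
      exact (hs0 t ht.2).2.2.2
    · simpa [indicator_of_notMem ht] using hK0
  have hHe : A.indicator (hh.1.mk h) =ᵐ[volume.restrict (Ioc 0 T₀)] h := by
    filter_upwards [hAe] with t ht
    rw [indicator_of_mem ht]
    exact (hs0 t ht.2).2.1
  have hF0 : ∀ t, t ∉ Ioc 0 T₀ → A.indicator (hf.mk f) t = 0 := fun t ht =>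
    indicator_of_notMem (fun h => ht h.1) _
  have hH0 : ∀ t, t ∉ Ioc 0 T₀ → A.indicator (hh.1.mk h) t = 0 := fun t ht =>
    indicator_of_notMem (fun h => ht h.1) _
  refine ⟨A.indicator (hf.mk f), A.indicator (hh.1.mk h), ⟨hFm, hHm, fun t => ?_, hF0, hH0, hFK,
    ?_, ?_⟩, ?_, hHe⟩
  · by_cases ht : t ∈ A
    · rw [indicator_of_mem ht, indicator_of_mem ht]
      exact (hs0 t ht.2).2.2.1
    · rw [indicator_of_notMem ht, indicator_of_notMem ht]
      exact hasGenAt_zero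
  · exact integrable_of_norm_le_of_ae_notMem (s := Ioc 0 T₀) hFm.aestronglyMeasurable (by simp)
      (Eventually.of_forall hFK) (Eventually.of_forall hF0)
  · exact IntegrableOn.integrable_of_forall_notMem_eq_zero (hh.congr hHe.symm) hH0
  · filter_upwards [hAe] with t ht
    rw [indicator_of_mem ht]
    exact (hs0 t ht.2).1

end Regular

/-! ### The terms of the solution as convolutions with the potential measure -/

section Representation

variable {B : Type*} [NormedAddCommGroup B] [NormedSpace ℝ B] {P : ℝ → B →L[ℝ] B}
  {Ω : Type*} [MeasurableSpace Ω] {μ : Measure Ω} {S : ℝ → Ω → ℝ} {ν : Measure ℝ}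
  {p : ℝ → ℝ → ℝ}

lemma HasBoundedDensities.ae_fst_potentialMeasure [SFinite μ] (hS : IsSubordinator S μ)
    (hp : HasBoundedDensities S μ p) {q : ℝ → Prop} (hq : ∀ᵐ x : ℝ, q x) :
    ∀ᵐ z ∂(potentialMeasure S μ), q z.1 := by
  rw [hp.potentialMeasure_eq hS]
  exact (withDensity_absolutelyContinuous _ _).ae_le
    (Measure.quasiMeasurePreserving_fst.ae (ae_restrict_of_ae hq))

lemma integral_Ioc_sInf_eq {s : ℝ → ℝ} (hs : MonotoneOn s (Ici 0)) {t : ℝ}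
    (hex : ∃ r, 0 < r ∧ t < s r) (φ : ℝ → B) :
    ∫ r in Ioc 0 (sInf {r | 0 < r ∧ t < s r}), φ r =
      ∫ r in Ioi 0, if s r ≤ t then φ r else 0 := by
  rw [← integral_indicator measurableSet_Ioc, ← integral_indicator measurableSet_Ioi]
  refine integral_congr_ae ?_
  have hbdd : BddBelow {r | 0 < r ∧ t < s r} := ⟨0, fun r hr => hr.1.le⟩
  filter_upwards [compl_mem_ae_iff.2 (measure_singleton (sInf {r | 0 < r ∧ t < s r}))] with r hr
  have hr : r ≠ sInf {r | 0 < r ∧ t < s r} := hr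
  by_cases hr0 : 0 < r
  · rcases lt_or_gt_of_ne hr with h | h
    · have h1 : s r ≤ t := by
        by_contra h2
        exact absurd (csInf_le hbdd ⟨hr0, not_le.1 h2⟩) (not_le.2 h)
      simp [indicator, hr0, h.le, h1]
    · have h1 : ¬ s r ≤ t := by
        obtain ⟨r', hr', hlt⟩ := exists_lt_of_csInf_lt hex h
        exact not_le.2 (hr'.2.trans_le (hs hr'.1.le hr0.le hlt.le))
      simp [indicator, h1, h]
  · simp [indicator, hr0]

/-- Almost every path leaves every bounded interval, because the expected time spent below a level
is finite. -/
lemma IsDriftlessSubordinator.ae_exists_gt [IsProbabilityMeasure μ]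
    (hS : IsDriftlessSubordinator S ν μ) (hν : ν (Ioi 0) = ⊤) (t : ℝ) :
    ∀ᵐ ω ∂μ, ∃ r, 0 < r ∧ t < S r ω := by
  have hms : MeasurableSet {z : ℝ × ℝ | z.1 ≤ t} := measurableSet_le measurable_fst measurable_const
  have h1 : Integrable ({z : ℝ × ℝ | z.1 ≤ t}.indicator fun _ => (1 : ℝ)) (potentialMeasure S μ) :=
    (integrable_indicator_iff hms).2 (integrableOn_const (hS.potentialMeasure_lt_top hν t).ne)
  have h2 := integrable_prod_of_potentialMeasure hS.subordinator h1
  filter_upwards [h2.prod_right_ae] with ω hω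
  by_contra! hcon
  have h3 : IntegrableOn (fun _ : ℝ => (1 : ℝ)) (Ioi 0) := by
    refine IntegrableOn.congr_fun hω (fun r hr => ?_) measurableSet_Ioi
    simp [indicator, hcon r hr]
  simp [integrableOn_const_iff] at h3

/-- `E[P_{E_t} g] = g + ∫_0^∞ P(S_r ≤ t) P_r L g dr`, the integral being the convolution of the
potential measure with the constant `L g`. -/
lemma inverseSubordinator_integral [CompleteSpace B] [IsProbabilityMeasure μ] (hP : IsBoundedC0Semigroup P)
    (hS : IsDriftlessSubordinator S ν μ) (hν : ν (Ioi 0) = ⊤) (hp : HasBoundedDensities S μ p)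
    {g h : B} (hg : HasGenAt P g h) {T₀ t : ℝ} (ht : t ∈ Ioc 0 T₀) :
    Integrable (fun ω => P (inverseSubordinator S t ω) g) μ ∧
      ∫ ω, P (inverseSubordinator S t ω) g ∂μ =
        g + timeConv P (potentialMeasure S μ) ((Ioc 0 T₀).indicator fun _ => h) t := by
  have hs := hS.subordinator
  have hF : StronglyMeasurable ((Ioc 0 T₀).indicator fun _ => h) :=
    stronglyMeasurable_const.indicator measurableSet_Ioc
  have hi := integrable_timeConv_of_bounded hP (hp.ae_potentialMeasure_pos hs)
    (hS.potentialMeasure_lt_top hν) hF (K := ‖h‖) (fun s => norm_indicator_le_norm_self _ _)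
    (fun s hs => indicator_of_notMem (fun h => absurd h.1 (not_lt.2 hs)) _) t
  have hi' := integrable_prod_of_potentialMeasure hs hi
  have hne : ∀ᵐ z ∂(potentialMeasure S μ), 0 < z.1 ∧ z.1 ≠ t :=
    ((hp.ae_potentialMeasure_pos hs).and (hp.ae_fst_potentialMeasure hs
      (q := fun x => x ≠ t) (by simp [ae_iff]))).mono fun z hz => ⟨hz.1.1, hz.2⟩
  have hne' := Measure.ae_ae_of_ae_prod (ae_of_ae_map hs.aemeasurable_graph hne)
  have key : ∀ᵐ ω ∂μ, g + ∫ r in Ioi 0, P r ((Ioc 0 T₀).indicator (fun _ => h) (t - S r ω)) =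
      P (inverseSubordinator S t ω) g := by
    filter_upwards [hS.ae_exists_gt hν t, hs.monotone, hne'] with ω h1 h2 h3
    have h4 : 0 ≤ inverseSubordinator S t ω := Real.sInf_nonneg fun r hr => hr.1.le
    have h5 := hg.integral_apply hP h4
    rw [inverseSubordinator, integral_Ioc_sInf_eq h2 h1, ← inverseSubordinator] at h5
    rw [sub_eq_iff_eq_add'.1 h5.symm]
    congr 1
    refine integral_congr_ae ?_
    filter_upwards [h3] with r hr
    by_cases hle : S r ω ≤ t
    · have : t - S r ω ∈ Ioc 0 T₀ :=
        ⟨sub_pos.2 (lt_of_le_of_ne hle hr.2), by linarith [hr.1, ht.2]⟩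
      rw [indicator_of_mem this, if_pos hle]
    · have : t - S r ω ∉ Ioc 0 T₀ := fun hmem => hle (by linarith [hmem.1])
      rw [indicator_of_notMem this, if_neg hle, map_zero]
  refine ⟨((integrable_const g).add hi'.integral_prod_left).congr key, ?_⟩
  rw [← integral_congr_ae key, integral_add (integrable_const g) hi'.integral_prod_left,
    timeConv, integral_potentialMeasure hs hi, integral_prod _ hi']
  simp

variable {T₀ : ℝ} {f F : ℝ → B}

lemma ae_ite_eq [IsProbabilityMeasure μ] (hS : IsSubordinator S μ)
    (hp : HasBoundedDensities S μ p) (hF0 : ∀ t, t ∉ Ioc 0 T₀ → F t = 0)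
    (hfF : F =ᵐ[volume.restrict (Ioc 0 T₀)] f) {t : ℝ} (ht : t ∈ Ioc 0 T₀) :
    ∀ᵐ z ∂(potentialMeasure S μ),
      P z.2 (F (t - z.1)) = if z.1 < t then P z.2 (f (t - z.1)) else 0 := by
  have h1 : ∀ᵐ x : ℝ, t - x ∈ Ioc 0 T₀ → F (t - x) = f (t - x) :=
    (Measure.measurePreserving_sub_left volume t).quasiMeasurePreserving.ae
      ((ae_restrict_iff' measurableSet_Ioc).1 hfF)
  filter_upwards [hp.ae_fst_potentialMeasure hS h1, hp.ae_potentialMeasure_pos hS] with z hz hz0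
  split_ifs with h
  · rw [hz ⟨by linarith, by linarith [hz0.1, ht.2]⟩]
  · rw [hF0 _ (fun hmem => h (by linarith [hmem.1])), map_zero]

/-- The inhomogeneous term in its two forms, through the densities and through the paths of `S`,
with absolute convergence. -/
lemma inhomogeneous_term [IsProbabilityMeasure μ] (hP : IsBoundedC0Semigroup P)
    (hS : IsDriftlessSubordinator S ν μ) (hν : ν (Ioi 0) = ⊤) (hp : HasBoundedDensities S μ p)
    (hF : StronglyMeasurable F) {K : ℝ} (hK : ∀ t, ‖F t‖ ≤ K)
    (hF0 : ∀ t, t ∉ Ioc 0 T₀ → F t = 0)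
    (hfF : F =ᵐ[volume.restrict (Ioc 0 T₀)] f) {t : ℝ} (ht : t ∈ Ioc 0 T₀) :
    IntegrableOn (fun q : ℝ × ℝ => p q.2 (t - q.1) • P q.2 (f q.1)) (Ioc 0 t ×ˢ Ioi 0) ∧
    Integrable (fun q : Ω × ℝ => if S q.2 q.1 < t then P q.2 (f (t - S q.2 q.1)) else 0)
        (μ.prod (volume.restrict (Ioi 0))) ∧
    ∫ s in Ioc 0 t, ∫ r in Ioi (0 : ℝ), p r (t - s) • P r (f s) =
      timeConv P (potentialMeasure S μ) F t ∧
    ∫ ω, (∫ r in Ioi (0 : ℝ), if S r ω < t then P r (f (t - S r ω)) else 0) ∂μ =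
      timeConv P (potentialMeasure S μ) F t := by
  have hs := hS.subordinator
  have hi := integrable_timeConv_of_bounded hP (hp.ae_potentialMeasure_pos hs)
    (hS.potentialMeasure_lt_top hν) hF hK
    (fun s hs => hF0 s fun h => absurd h.1 (not_lt.2 hs)) t
  have hae := ae_ite_eq (P := P) hs hp hF0 hfF ht
  have hi1 := hi.congr hae
  have hi2 := integrable_prod_of_potentialMeasure hs hi1
  have hpm : Measurable fun z : ℝ × ℝ => ENNReal.ofReal (p z.2 z.1) :=
    (hp.measurable.comp measurable_swap).ennreal_ofReal
  have hsm : MeasurableSet {z : ℝ × ℝ | z.1 < t} := measurableSet_lt measurable_fst measurable_const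
  -- the substitution `x = t - s` in the position variable
  have hφ : MeasurePreserving (fun q : ℝ × ℝ => (t - q.1, q.2))
      ((volume.restrict (Ioo 0 t)).prod (volume.restrict (Ioi 0)))
      ((volume.restrict (Ioo 0 t)).prod (volume.restrict (Ioi 0))) := by
    have h1 : MeasurePreserving (fun y : ℝ => t - y) (volume.restrict (Ioo 0 t))
        (volume.restrict (Ioo 0 t)) := by
      have := (Measure.measurePreserving_sub_left volume t).restrict_preimage
        (measurableSet_Ioo (a := 0) (b := t))
      simpa using this
    exact h1.prod (MeasurePreserving.id _)
  have hrestr : ((volume.restrict (Ioi 0)).prod (volume.restrict (Ioi 0))).restrict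
      {z : ℝ × ℝ | z.1 < t} = (volume.restrict (Ioo 0 t)).prod (volume.restrict (Ioi (0 : ℝ))) := by
    have : {z : ℝ × ℝ | z.1 < t} = Iio t ×ˢ univ := by ext; simp
    rw [this, ← Measure.prod_restrict, Measure.restrict_univ,
      Measure.restrict_restrict measurableSet_Iio, inter_comm, Ioi_inter_Iio]
  have hfun : ∀ z : ℝ × ℝ, (ENNReal.ofReal (p z.2 z.1)).toReal •
      (if z.1 < t then P z.2 (f (t - z.1)) else 0) = {z : ℝ × ℝ | z.1 < t}.indicator
      (fun z => (ENNReal.ofReal (p z.2 z.1)).toReal • P z.2 (f (t - z.1))) z := by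
    intro z
    by_cases h : z.1 < t <;> simp [indicator, h]
  have hae2 : ∀ᵐ z ∂((volume.restrict (Ioo 0 t)).prod (volume.restrict (Ioi (0 : ℝ)))),
      (ENNReal.ofReal (p z.2 z.1)).toReal • P z.2 (f (t - z.1)) =
        p z.2 z.1 • P z.2 (f (t - z.1)) := by
    rw [Measure.prod_restrict]
    filter_upwards [ae_restrict_mem (measurableSet_Ioo.prod measurableSet_Ioi)] with z hz
    rw [ENNReal.toReal_ofReal (hp.nonneg _ _ hz.2 hz.1.1)]
  have hd1 : Integrable (fun z : ℝ × ℝ => p z.2 z.1 • P z.2 (f (t - z.1)))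
      ((volume.restrict (Ioo 0 t)).prod (volume.restrict (Ioi 0))) := by
    rw [hp.potentialMeasure_eq hs, integrable_withDensity_iff_integrable_smul' hpm (by simp)] at hi1
    simp_rw [hfun] at hi1
    rw [integrable_indicator_iff hsm, IntegrableOn, hrestr] at hi1
    exact hi1.congr hae2
  have hd2 : timeConv P (potentialMeasure S μ) F t =
      ∫ z, p z.2 z.1 • P z.2 (f (t - z.1))
        ∂((volume.restrict (Ioo 0 t)).prod (volume.restrict (Ioi 0))) := by
    rw [timeConv, integral_congr_ae hae, hp.potentialMeasure_eq hs,
      integral_withDensity_eq_integral_toReal_smul hpm (by simp)]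
    simp_rw [hfun]
    rw [integral_indicator hsm, hrestr, integral_congr_ae hae2]
  have hd3 : Integrable (fun z : ℝ × ℝ => p z.2 (t - z.1) • P z.2 (f z.1))
      ((volume.restrict (Ioo 0 t)).prod (volume.restrict (Ioi 0))) := by
    have := hφ.integrable_comp_of_integrable hd1
    simpa [Function.comp_def] using this
  have hIoo : (volume.restrict (Ioc 0 t)).prod (volume.restrict (Ioi (0 : ℝ))) =
      (volume.restrict (Ioo 0 t)).prod (volume.restrict (Ioi 0)) := by
    rw [restrict_Ioo_eq_restrict_Ioc]
  refine ⟨?_, hi2, ?_, ?_⟩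
  · rw [IntegrableOn, Measure.volume_eq_prod, ← Measure.prod_restrict, hIoo]
    exact hd3
  · have hemb : MeasurableEmbedding fun q : ℝ × ℝ => (t - q.1, q.2) :=
      ((MeasurableEquiv.subLeft t).prodCongr (MeasurableEquiv.refl ℝ)).measurableEmbedding
    rw [hd2, ← hφ.integral_comp hemb, integral_Ioc_eq_integral_Ioo, integral_prod]
    · simp
    · simpa using hd3
  · rw [timeConv, integral_congr_ae hae, integral_potentialMeasure hs hi1, integral_prod _ hi2]

end Representation

/-! ### Convolutions on the half-line -/

section HalfLine

variable {E : Type*} [NormedAddCommGroup E] {F : ℝ → E} {ν : Measure ℝ}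

lemma IsSubordinatorLevyMeasure.integrable_tailMeasure (hν : IsSubordinatorLevyMeasure ν)
    (hFm : StronglyMeasurable F) (hF : ∀ s ≤ 0, F s = 0) {t K : ℝ} (hK : ∀ s ≤ t, ‖F s‖ ≤ K) :
    Integrable (fun y => F (t - y)) (tailMeasure ν) := by
  refine integrable_of_norm_le_of_ae_notMem (s := Iic t) (C := K)
    (hFm.comp_measurable (by fun_prop)).aestronglyMeasurable (hν.tailMeasure_Iic_lt_top t) ?_ ?_
  · filter_upwards [ae_tailMeasure_pos ν] with y hy using hK _ (by linarith)
  · exact Eventually.of_forall fun y hy => hF _ (by simp at hy; linarith)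

lemma measurePreserving_sub_left_Ioi (t : ℝ) :
    MeasurePreserving (fun y : ℝ => t - y) (volume.restrict (Ioi 0)) (volume.restrict (Iio t)) := by
  have := (Measure.measurePreserving_sub_left volume t).restrict_preimage
    (measurableSet_Iio (a := t))
  simpa using this

lemma integrableOn_Ioi_sub_left {t : ℝ} (h : IntegrableOn (fun y => F (t - y)) (Ioi 0)) :
    IntegrableOn F (Ioc 0 t) := by
  have h1 := ((measurePreserving_sub_left_Ioi t).integrable_comp_emb
    (MeasurableEquiv.subLeft t).measurableEmbedding).1 h
  have h2 : IntegrableOn F (Iic t) := (integrableOn_Iic_iff_integrableOn_Iio (by simp)).2 h1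
  exact h2.mono_set Ioc_subset_Iic_self

variable [NormedSpace ℝ E]

lemma integral_Ioi_sub_left (hF : ∀ s ≤ 0, F s = 0) (t : ℝ) :
    ∫ y in Ioi 0, F (t - y) = ∫ s in Ioc 0 t, F s := by
  rw [(measurePreserving_sub_left_Ioi t).integral_comp
    (MeasurableEquiv.subLeft t).measurableEmbedding, ← integral_Iic_eq_integral_Iio]
  refine setIntegral_eq_of_subset_of_forall_sdiff_eq_zero measurableSet_Iic Ioc_subset_Iic_self
    fun s hs => hF s ?_
  by_contra h
  exact hs.2 ⟨not_le.1 h, hs.1⟩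

lemma IsSubordinatorLevyMeasure.ae_tail_lt_top (hν : IsSubordinatorLevyMeasure ν) :
    ∀ᵐ y ∂(volume.restrict (Ioi (0 : ℝ))), ν (Ioi y) < ⊤ := by
  filter_upwards [ae_restrict_mem measurableSet_Ioi] with y hy using hν.tail_lt_top hy

lemma IsSubordinatorLevyMeasure.integral_tailMeasure (hν : IsSubordinatorLevyMeasure ν)
    (hF : ∀ s ≤ 0, F s = 0) (t : ℝ) :
    ∫ y, F (t - y) ∂(tailMeasure ν) = ∫ s in Ioc 0 t, weight ν (t - s) • F s := by
  rw [tailMeasure, integral_withDensity_eq_integral_toReal_smul (measurable_tail ν)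
    hν.ae_tail_lt_top, ← integral_Ioi_sub_left (F := fun s => weight ν (t - s) • F s)
    (fun s hs => by rw [hF s hs, smul_zero])]
  simp [weight]

lemma IsSubordinatorLevyMeasure.integrableOn_weight (hν : IsSubordinatorLevyMeasure ν) {t : ℝ}
    (h : Integrable (fun y => F (t - y)) (tailMeasure ν)) :
    IntegrableOn (fun s => weight ν (t - s) • F s) (Ioc 0 t) := by
  rw [tailMeasure, integrable_withDensity_iff_integrable_smul' (measurable_tail ν)
    hν.ae_tail_lt_top] at h
  refine integrableOn_Ioi_sub_left ?_
  simpa [weight, IntegrableOn] using h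

/-- Two integrable functions with the same primitive agree almost everywhere. -/
lemma ae_eq_of_integral_Ioc_eq [CompleteSpace E] {F G : ℝ → E} {T : ℝ} (hT : 0 < T)
    (hF : IntegrableOn F (Ioc 0 T)) (hG : IntegrableOn G (Ioc 0 T))
    (h : ∀ t ∈ Ioc 0 T, ∫ s in Ioc 0 t, F s = ∫ s in Ioc 0 t, G s) :
    F =ᵐ[volume.restrict (Ioc 0 T)] G := by
  have hF' := (intervalIntegrable_iff_integrableOn_Ioc_of_le hT.le).2 hF
  have hG' := (intervalIntegrable_iff_integrableOn_Ioc_of_le hT.le).2 hG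
  rw [← restrict_Ioo_eq_restrict_Ioc]
  filter_upwards [ae_restrict_of_ae hF'.ae_hasDerivAt_integral,
    ae_restrict_of_ae hG'.ae_hasDerivAt_integral, ae_restrict_mem measurableSet_Ioo] with t h1 h2 ht
  have htm : t ∈ uIcc 0 T := by
    rw [uIcc_of_le hT.le]
    exact ⟨ht.1.le, ht.2.le⟩
  refine (h1 htm 0 left_mem_uIcc).unique ((h2 htm 0 left_mem_uIcc).congr_of_eventuallyEq ?_)
  filter_upwards [Ioo_mem_nhds ht.1 ht.2] with s hs
  rw [intervalIntegral.integral_of_le hs.1.le, intervalIntegral.integral_of_le hs.1.le,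
    h s ⟨hs.1, hs.2.le⟩]

end HalfLine

/-! ### The convolution equations -/

section Equations

variable {B : Type*} [NormedAddCommGroup B] [NormedSpace ℝ B] {P : ℝ → B →L[ℝ] B}
  {Ω : Type*} [MeasurableSpace Ω] {μ : Measure Ω} [IsProbabilityMeasure μ] {S : ℝ → Ω → ℝ}
  {ν : Measure ℝ} {p : ℝ → ℝ → ℝ} {F H : ℝ → B}

lemma timeConv_add {m : Measure (ℝ × ℝ)} {t : ℝ} (hF : Integrable (fun z => P z.2 (F (t - z.1))) m)
    (hH : Integrable (fun z => P z.2 (H (t - z.1))) m) :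
    timeConv P m (fun s => F s + H s) t = timeConv P m F t + timeConv P m H t := by
  simp only [timeConv, map_add]
  exact integral_add hF hH

lemma integrable_spaceConv (hP : IsBoundedC0Semigroup P) {W : Measure ℝ} {m : Measure (ℝ × ℝ)}
    (hm : ∀ᵐ z ∂m, 0 < z.1 ∧ 0 < z.2) (hF : StronglyMeasurable F) {t : ℝ}
    (h : Integrable (fun q : ℝ × ℝ × ℝ => P q.2.2 (F (t - q.1 - q.2.1))) (W.prod m)) :
    Integrable (fun z => P z.2 (F (t - z.1))) (spaceConv W m) := by
  have h0 : ∀ᵐ z ∂(spaceConv W m), 0 < z.2 := by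
    refine (ae_map_iff measurable_spaceConv_map.aemeasurable
      (measurableSet_lt measurable_const measurable_snd)).2 ?_
    exact (Measure.quasiMeasurePreserving_snd.ae hm).mono fun q hq => hq.2
  rw [spaceConv, integrable_map_measure _ measurable_spaceConv_map.aemeasurable]
  · simpa only [Function.comp_def, ← sub_sub] using h
  · exact hP.aestronglyMeasurable_comp hF (by fun_prop) (by fun_prop) (h0.mono fun z hz => hz.le)

variable {T₀ K : ℝ}

lemma IsRegular.eq_zero_of_nonpos (h : IsRegular P T₀ K F H) : ∀ t ≤ 0, F t = 0 := fun t ht =>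
  h.eq_zero t fun hmem => absurd hmem.1 (not_lt.2 ht)

lemma IsRegular.gen_eq_zero_of_nonpos (h : IsRegular P T₀ K F H) : ∀ t ≤ 0, H t = 0 := fun t ht =>
  h.gen_eq_zero t fun hmem => absurd hmem.1 (not_lt.2 ht)

lemma isRegular_indicator {g h : B} (hg : HasGenAt P g h) :
    IsRegular P T₀ ‖g‖ ((Ioc 0 T₀).indicator fun _ => g) ((Ioc 0 T₀).indicator fun _ => h) where
  stronglyMeasurable := stronglyMeasurable_const.indicator measurableSet_Ioc
  stronglyMeasurable_gen := stronglyMeasurable_const.indicator measurableSet_Ioc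
  hasGenAt t := by
    by_cases ht : t ∈ Ioc 0 T₀
    · simpa only [indicator_of_mem ht] using hg
    · simpa only [indicator_of_notMem ht] using hasGenAt_zero
  eq_zero t ht := indicator_of_notMem ht _
  gen_eq_zero t ht := indicator_of_notMem ht _
  norm_le t := norm_indicator_le_norm_self _ _
  integrable := (integrable_indicator_iff measurableSet_Ioc).2 (integrableOn_const (by simp))
  integrable_gen := (integrable_indicator_iff measurableSet_Ioc).2 (integrableOn_const (by simp))

/-- The convolution of `w` with `timeConv`, for a bounded inhomogeneity. -/
lemma integral_tailMeasure_timeConv (hP : IsBoundedC0Semigroup P)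
    (hS : IsDriftlessSubordinator S ν μ) (hν : ν (Ioi 0) = ⊤) (hp : HasBoundedDensities S μ p)
    (hF : StronglyMeasurable F) (hK : ∀ t, ‖F t‖ ≤ K) (hF0 : ∀ t ≤ 0, F t = 0) (t : ℝ) :
    ∫ y, timeConv P (potentialMeasure S μ) F (t - y) ∂(tailMeasure ν) =
      timeConv P (spaceConv (tailMeasure ν) (potentialMeasure S μ)) F t :=
  integral_timeConv_sub hP (hp.ae_potentialMeasure_pos hS.subordinator) hF t
    (integrable_prod_of_bounded hP (hp.ae_potentialMeasure_pos hS.subordinator)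
      (hS.potentialMeasure_lt_top hν) (ae_tailMeasure_pos ν) hS.levy.tailMeasure_Iic_lt_top hF hK
      hF0 t)

/-- The primitive of `timeConv`, for an integrable inhomogeneity. -/
lemma integral_Ioc_timeConv (hP : IsBoundedC0Semigroup P)
    (hS : IsDriftlessSubordinator S ν μ) (hν : ν (Ioi 0) = ⊤) (hp : HasBoundedDensities S μ p)
    (hF : StronglyMeasurable F) (hFi : Integrable F) (hF0 : ∀ t ≤ 0, F t = 0) (t : ℝ) :
    ∫ s in Ioc 0 t, timeConv P (potentialMeasure S μ) F s =
      timeConv P (spaceConv (volume.restrict (Ioi 0)) (potentialMeasure S μ)) F t := by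
  have hm := hp.ae_potentialMeasure_pos hS.subordinator
  rw [← integral_timeConv_sub hP hm hF t
    (integrable_prod_of_integrable hP hm (hS.potentialMeasure_lt_top hν) hF hFi hF0 t),
    integral_Ioi_sub_left fun s hs =>
      timeConv_potentialMeasure_of_nonpos hS.subordinator hp hF0 hs]

variable [CompleteSpace B]

/-- With `A_s = E[P_{E_s} ·]`, the convolution of `A` with `F` is `∫ F` plus the convolution of the
integrated potential operators with `L F`. -/
lemma IsRegular.timeConv_eq_add (hP : IsBoundedC0Semigroup P)
    (hS : IsDriftlessSubordinator S ν μ) (hν : ν (Ioi 0) = ⊤) (hp : HasBoundedDensities S μ p)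
    (h : IsRegular P T₀ K F H) (t : ℝ) :
    timeConv P (spaceConv (tailMeasure ν) (potentialMeasure S μ)) F t =
      (∫ s in Ioc 0 t, F s) +
        timeConv P (spaceConv (volume.restrict (Ioi 0)) (potentialMeasure S μ)) H t := by
  have hm := hp.ae_potentialMeasure_pos hS.subordinator
  rw [← integral_Ioi_sub_left h.eq_zero_of_nonpos]
  exact integral_apply_eq_add hP (ae_spaceConv (ae_tailMeasure_pos ν) hm)
    (hS.map_fst_spaceConv hν hp) (hS.spaceConv_volume hν) (H := fun x => F (t - x))
    (H' := fun x => H (t - x)) (h.stronglyMeasurable.comp_measurable (by fun_prop))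
    (h.integrable.comp_sub_left t).integrableOn
    (integrable_spaceConv hP hm h.stronglyMeasurable_gen (integrable_prod_of_integrable hP hm
      (hS.potentialMeasure_lt_top hν) h.stronglyMeasurable_gen h.integrable_gen
      h.gen_eq_zero_of_nonpos t)) fun x => h.hasGenAt _

/-- The generator acts under the convolution with the potential measure, at almost all times. -/
lemma IsRegular.hasGenAt_timeConv (hP : IsBoundedC0Semigroup P)
    (hS : IsDriftlessSubordinator S ν μ) (hν : ν (Ioi 0) = ⊤) (hp : HasBoundedDensities S μ p)
    (h : IsRegular P T₀ K F H) :
    (∀ᵐ t ∂(volume.restrict (Ioc 0 T₀)), HasGenAt P (timeConv P (potentialMeasure S μ) F t)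
      (timeConv P (potentialMeasure S μ) H t)) ∧
    IntegrableOn (timeConv P (potentialMeasure S μ) H) (Ioc 0 T₀) := by
  have hm := hp.ae_potentialMeasure_pos hS.subordinator
  have hmT := hS.potentialMeasure_lt_top hν
  have hi := integrable_timeConv_prod hP hm hmT h.stronglyMeasurable_gen h.integrable_gen
    h.gen_eq_zero_of_nonpos T₀
  refine ⟨?_, IntegrableOn.mono_set (hi.integral_prod_left :) Ioc_subset_Iic_self⟩
  have h1 := ae_mono (Measure.restrict_mono (Ioc_subset_Iic_self (a := 0)) le_rfl) hi.prod_right_ae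
  filter_upwards [h1] with t ht
  refine HasGenAt.integral hP (integrable_timeConv_of_bounded hP hm hmT h.stronglyMeasurable
    h.norm_le h.eq_zero_of_nonpos t) ht ?_
  filter_upwards [hm] with z hz using (h.hasGenAt _).apply hP hz.2.le

/-- The homogeneous solution `A_t g = E[P_{E_t} g]` lies in the domain of the generator for almost
all `t`, although `t ↦ L g` need not take values there: disintegrating the laws of the inverse
subordinator gives `L A_t g = A_t L g`. -/
lemma exists_gen_homogeneous (hP : IsBoundedC0Semigroup P)
    (hS : IsDriftlessSubordinator S ν μ) (hν : ν (Ioi 0) = ⊤) (hp : HasBoundedDensities S μ p)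
    {g h : B} (hg : HasGenAt P g h) (hT₀ : 0 < T₀) :
    ∃ A : ℝ → B, IntegrableOn A (Ioc 0 T₀) ∧
      (∀ᵐ t ∂(volume.restrict (Ioc 0 T₀)), HasGenAt P
        (g + timeConv P (potentialMeasure S μ) ((Ioc 0 T₀).indicator fun _ => h) t) (A t)) ∧
      ∀ t ∈ Ioc 0 T₀, ∫ s in Ioc 0 t, A s = timeConv P
        (spaceConv (tailMeasure ν) (potentialMeasure S μ)) ((Ioc 0 T₀).indicator fun _ => h) t := by
  have hm := hp.ae_potentialMeasure_pos hS.subordinator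
  have hQ := ae_spaceConv (ae_tailMeasure_pos ν) hm
  set Q := spaceConv (tailMeasure ν) (potentialMeasure S μ) with hQdef
  set ρ := Q.restrict (Prod.fst ⁻¹' Ioc 0 T₀) with hρ
  have hfst : ρ.fst = volume.restrict (Ioc 0 T₀) := by
    rw [Measure.fst, hρ, ← Measure.restrict_map measurable_fst measurableSet_Ioc,
      hS.map_fst_spaceConv hν hp, Measure.restrict_restrict measurableSet_Ioc,
      inter_eq_left.2 Ioc_subset_Ioi_self]
  have hfin : IsFiniteMeasure ρ := by
    refine ⟨?_⟩
    rw [← Measure.fst_univ, hfst]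
    simp
  have hρpos : ∀ᵐ z ∂ρ, 0 < z.1 ∧ 0 < z.2 := ae_restrict_of_ae hQ
  have hρi : ∀ x : B, Integrable (fun z : ℝ × ℝ => P z.2 x) ρ := fun x =>
    hP.integrable_apply (by fun_prop) (integrable_const x) (hρpos.mono fun z hz => hz.2.le)
  have hAi : ∀ x : B, IntegrableOn (fun s => ∫ r, P r x ∂(ρ.condKernel s)) (Ioc 0 T₀) := by
    intro x
    have := (hρi x).integral_condKernel
    rwa [hfst] at this
  have hA : ∀ x : B, ∀ t ∈ Ioc 0 T₀, ∫ s in Ioc 0 t, (∫ r, P r x ∂(ρ.condKernel s)) =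
      timeConv P Q ((Ioc 0 T₀).indicator fun _ => x) t := by
    intro x t ht
    -- the indicator vanishes at `t - x = 0`, so the null set `{t}` is dropped from `(0, t]`
    have h1 := Measure.setIntegral_condKernel_univ_right (measurableSet_Ioo (a := 0) (b := t))
      (hρi x).integrableOn
    rw [hfst, Measure.restrict_restrict measurableSet_Ioo, inter_eq_left.2
      (Ioo_subset_Ioc_self.trans (Ioc_subset_Ioc_right ht.2)), ← integral_Ioc_eq_integral_Ioo] at h1
    rw [h1, timeConv, hρ, Measure.restrict_restrict (measurableSet_Ioo.prod .univ),
      ← integral_indicator ((measurableSet_Ioo.prod .univ).inter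
        (measurable_fst measurableSet_Ioc))]
    refine integral_congr_ae ?_
    filter_upwards [hQ] with z hz
    by_cases hlt : z.1 < t
    · have h2 : z ∈ (Ioo 0 t ×ˢ univ) ∩ Prod.fst ⁻¹' Ioc 0 T₀ :=
        ⟨⟨⟨hz.1, hlt⟩, trivial⟩, hz.1, (hlt.trans_le ht.2).le⟩
      have h3 : t - z.1 ∈ Ioc 0 T₀ := ⟨sub_pos.2 hlt, by linarith [hz.1, ht.2]⟩
      rw [indicator_of_mem h2, indicator_of_mem h3]
    · rw [indicator_of_notMem fun hmem => hlt hmem.1.1.2,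
        indicator_of_notMem fun hmem => hlt (sub_pos.1 hmem.1), map_zero]
  refine ⟨fun s => ∫ r, P r h ∂(ρ.condKernel s), hAi h, ?_, hA h⟩
  have hreg := isRegular_indicator (T₀ := T₀) hg
  have hhm : StronglyMeasurable ((Ioc 0 T₀).indicator fun _ => h) := hreg.stronglyMeasurable_gen
  have hcont := continuous_timeConv_potentialMeasure hP hS hν hp hhm hreg.integrable_gen
    (K := ‖h‖) (fun s => norm_indicator_le_norm_self _ _) hreg.gen_eq_zero_of_nonpos
  have hae : (fun s => ∫ r, P r g ∂(ρ.condKernel s)) =ᵐ[volume.restrict (Ioc 0 T₀)] fun s =>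
      g + timeConv P (potentialMeasure S μ) ((Ioc 0 T₀).indicator fun _ => h) s := by
    refine ae_eq_of_integral_Ioc_eq hT₀ (hAi g)
      ((continuous_const.add hcont).integrableOn_Icc.mono_set Ioc_subset_Icc_self)
      fun t ht => ?_
    rw [hA g t ht, hreg.timeConv_eq_add hP hS hν hp,
      ← integral_Ioc_timeConv hP hS hν hp hhm hreg.integrable_gen hreg.gen_eq_zero_of_nonpos,
      integral_add (integrable_const g)
        (hcont.integrableOn_Icc.mono_set Ioc_subset_Icc_self)]
    congr 1
    refine setIntegral_congr_fun measurableSet_Ioc fun s hs => ?_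
    exact indicator_of_mem (Ioc_subset_Ioc_right ht.2 hs) _
  have h1 : ∀ᵐ s ∂(volume.restrict (Ioc 0 T₀)), HasGenAt P (∫ r, P r g ∂(ρ.condKernel s))
      (∫ r, P r h ∂(ρ.condKernel s)) := by
    have h2 : ∀ᵐ z ∂(ρ.fst ⊗ₘ ρ.condKernel), 0 < z.2 := by
      rw [ρ.disintegrate ρ.condKernel]
      exact hρpos.mono fun z hz => hz.2
    rw [← hfst]
    filter_upwards [(hρi g).condKernel_ae, (hρi h).condKernel_ae,
      Measure.ae_ae_of_ae_compProd h2] with s h3 h4 h5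
    refine HasGenAt.integral hP h3 h4 ?_
    filter_upwards [h5] with r hr using hg.apply hP (le_of_lt hr)
  filter_upwards [hae, h1] with s h2 h3
  rw [← h2]
  exact h3

end Equations

/-! ### Existence and uniqueness -/

section Solution

variable {B : Type*} [NormedAddCommGroup B] [NormedSpace ℝ B] [CompleteSpace B]
  {P : ℝ → B →L[ℝ] B}
  {Ω : Type*} [MeasurableSpace Ω] {μ : Measure Ω} [IsProbabilityMeasure μ] {S : ℝ → Ω → ℝ}
  {ν : Measure ℝ} {p : ℝ → ℝ → ℝ} {F H f u v : ℝ → B} {T₀ K : ℝ} {g h : B}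

/-- A function of the form `g + U * (L g + f)`, with `U` the potential measure acting through the
semigroup, is a strong solution: convolving with `w` turns `U` into the laws of the inverse
subordinator. -/
lemma isStrongSolution_of_eq_timeConv (hP : IsBoundedC0Semigroup P)
    (hS : IsDriftlessSubordinator S ν μ) (hν : ν (Ioi 0) = ⊤) (hp : HasBoundedDensities S μ p)
    (hT₀ : 0 < T₀) (hg : HasGenAt P g h) (hF : IsRegular P T₀ K F H)
    (hfF : F =ᵐ[volume.restrict (Ioc 0 T₀)] f)
    (hu : ∀ t ∈ Ioc 0 T₀, u t =
      g + timeConv P (potentialMeasure S μ) ((Ioc 0 T₀).indicator fun _ => h) t +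
        timeConv P (potentialMeasure S μ) F t) :
    IsStrongSolution ν P T₀ f g u := by
  have hs := hS.subordinator
  have hm := hp.ae_potentialMeasure_pos hs
  have hmT := hS.potentialMeasure_lt_top hν
  have hreg := isRegular_indicator (T₀ := T₀) hg
  set F₁ : ℝ → B := (Ioc 0 T₀).indicator fun _ => h with hF₁
  have hF₁m : StronglyMeasurable F₁ := hreg.stronglyMeasurable_gen
  have hF₁K : ∀ s, ‖F₁ s‖ ≤ ‖h‖ := fun s => norm_indicator_le_norm_self _ _
  -- `D` extends `u - g` by zero to the left of `0`
  set D : ℝ → B := timeConv P (potentialMeasure S μ) fun s => F₁ s + F s with hD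
  have hFm : StronglyMeasurable fun s => F₁ s + F s := hF₁m.add hF.stronglyMeasurable
  have hF0 : ∀ s ≤ 0, F₁ s + F s = 0 := fun s hs => by
    rw [hreg.gen_eq_zero_of_nonpos s hs, hF.eq_zero_of_nonpos s hs, add_zero]
  have hFK : ∀ s, ‖F₁ s + F s‖ ≤ ‖h‖ + K := fun s =>
    (norm_add_le _ _).trans (add_le_add (hF₁K s) (hF.norm_le s))
  have hDc : Continuous D := continuous_timeConv_potentialMeasure hP hS hν hp hFm
    (hreg.integrable_gen.add hF.integrable) hFK hF0
  have hD0 : ∀ s ≤ 0, D s = 0 := fun s hs' =>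
    timeConv_potentialMeasure_of_nonpos hs hp hF0 hs'
  have hDadd : ∀ t, D t = timeConv P (potentialMeasure S μ) F₁ t +
      timeConv P (potentialMeasure S μ) F t := fun t => timeConv_add
    (integrable_timeConv_of_bounded hP hm hmT hF₁m hF₁K hreg.gen_eq_zero_of_nonpos t)
    (integrable_timeConv_of_bounded hP hm hmT hF.stronglyMeasurable hF.norm_le
      hF.eq_zero_of_nonpos t)
  have huD : ∀ t ∈ Ioc 0 T₀, u t = g + D t := fun t ht => by rw [hu t ht, hDadd, add_assoc]
  obtain ⟨A, hAi, hA, hAint⟩ := exists_gen_homogeneous hP hS hν hp hg hT₀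
  obtain ⟨hgen, hgeni⟩ := hF.hasGenAt_timeConv hP hS hν hp
  have hLu : ∀ᵐ t ∂(volume.restrict (Ioc 0 T₀)),
      HasGenAt P (u t) (A t + timeConv P (potentialMeasure S μ) H t) := by
    filter_upwards [hA, hgen, ae_restrict_mem measurableSet_Ioc] with t h1 h2 ht
    rw [hu t ht]
    exact h1.add h2
  have hDb : ∃ C, ∀ t ∈ Icc 0 T₀, ‖D t‖ ≤ C :=
    isCompact_Icc.exists_bound_of_continuousOn hDc.continuousOn
  obtain ⟨C, hC⟩ := hDb
  have hDC : ∀ T ∈ Ioc 0 T₀, ∀ s ≤ T, ‖D s‖ ≤ C := by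
    intro T hT s hs
    rcases le_total s 0 with h0 | h0
    · rw [hD0 s h0, norm_zero]
      exact (norm_nonneg _).trans (hC 0 ⟨le_rfl, hT₀.le⟩)
    · exact hC s ⟨h0, hs.trans hT.2⟩
  have hwD : ∀ T ∈ Ioc 0 T₀, EqOn (fun t => weight ν (T - t) • D t)
      (fun t => weight ν (T - t) • (u t - g)) (Ioc 0 T) := by
    intro T hT t ht
    simp only
    rw [huD t (Ioc_subset_Ioc_right hT.2 ht), add_sub_cancel_left]
  refine ⟨⟨‖g‖ + C, fun t ht => ?_⟩, ?_, ?_, ?_, ?_, fun T hT => ?_, fun T hT => ?_⟩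
  · rw [huD t ht]
    exact (norm_add_le _ _).trans (add_le_add le_rfl (hC t ⟨ht.1.le, ht.2⟩))
  · exact (continuous_const.add hDc).continuousOn.congr huD
  · have h1 : Tendsto (fun t => g + D t) (𝓝[>] 0) (𝓝 g) := by
      have := (hDc.tendsto 0).const_add g
      rw [hD0 0 le_rfl, add_zero] at this
      exact this.mono_left nhdsWithin_le_nhds
    refine h1.congr' ?_
    filter_upwards [Ioc_mem_nhdsGT hT₀] with t ht using (huD t ht).symm
  · exact hLu.mono fun t ht => ht.mem_genDomain
  · exact (hAi.add hgeni).congr (hLu.mono fun t ht => ht.gen_eq.symm)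
  · exact (hS.levy.integrableOn_weight (hS.levy.integrable_tailMeasure hDc.stronglyMeasurable hD0
      (hDC T hT))).congr_fun (hwD T hT) measurableSet_Ioc
  · have hsub : Ioc 0 T ⊆ Ioc 0 T₀ := Ioc_subset_Ioc_right hT.2
    have hsplit : timeConv P (spaceConv (tailMeasure ν) (potentialMeasure S μ))
        (fun s => F₁ s + F s) T =
        timeConv P (spaceConv (tailMeasure ν) (potentialMeasure S μ)) F₁ T +
        timeConv P (spaceConv (tailMeasure ν) (potentialMeasure S μ)) F T :=
      timeConv_add
        (integrable_spaceConv hP hm hF₁m (integrable_prod_of_bounded hP hm hmT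
          (ae_tailMeasure_pos ν) hS.levy.tailMeasure_Iic_lt_top hF₁m hF₁K
          hreg.gen_eq_zero_of_nonpos T))
        (integrable_spaceConv hP hm hF.stronglyMeasurable (integrable_prod_of_bounded hP hm hmT
          (ae_tailMeasure_pos ν) hS.levy.tailMeasure_Iic_lt_top hF.stronglyMeasurable hF.norm_le
          hF.eq_zero_of_nonpos T))
    rw [← setIntegral_congr_fun measurableSet_Ioc (hwD T hT),
      ← hS.levy.integral_tailMeasure hD0,
      integral_tailMeasure_timeConv hP hS hν hp hFm hFK hF0, hsplit, ← hAint T hT,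
      hF.timeConv_eq_add hP hS hν hp, ← integral_Ioc_timeConv hP hS hν hp
        hF.stronglyMeasurable_gen hF.integrable_gen hF.gen_eq_zero_of_nonpos,
      ← integral_add hF.integrable.integrableOn (hgeni.mono_set hsub),
      ← integral_add (hAi.mono_set hsub)
        (by exact hF.integrable.integrableOn.add (hgeni.mono_set hsub))]
    refine integral_congr_ae ?_
    filter_upwards [ae_mono (Measure.restrict_mono hsub le_rfl) hLu,
      ae_mono (Measure.restrict_mono hsub le_rfl) hfF] with t h1 h2
    rw [h1.gen_eq, ← h2]
    abel

/-- Strong solutions with the same data agree. Convolving the equation `w * d = 1 * L d` of the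
difference `d` with the potential measure gives `1 * d + R = R`, hence `1 * d = 0`. -/
lemma IsStrongSolution.eqOn (hP : IsBoundedC0Semigroup P)
    (hS : IsDriftlessSubordinator S ν μ) (hν : ν (Ioi 0) = ⊤) (hp : HasBoundedDensities S μ p)
    (hT₀ : 0 < T₀) (hf : IntegrableOn f (Ioc 0 T₀)) (hu : IsStrongSolution ν P T₀ f g u)
    (hv : IsStrongSolution ν P T₀ f g v) : EqOn v u (Ioc 0 T₀) := by
  have hs := hS.subordinator
  have hm := hp.ae_potentialMeasure_pos hs
  have hmT := hS.potentialMeasure_lt_top hν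
  obtain ⟨C₁, hC₁⟩ := hu.bounded
  obtain ⟨C₂, hC₂⟩ := hv.bounded
  obtain ⟨D, L, hD, hDd, hLd⟩ := exists_isRegular (P := P) (T₀ := T₀) (K := max (C₂ + C₁) 0)
    (f := fun t => v t - u t) (h := fun t => gen P (v t) - gen P (u t)) (le_max_right _ _)
    ((hv.continuousOn.sub hu.continuousOn).aestronglyMeasurable measurableSet_Ioc)
    (hv.integrable_gen.sub hu.integrable_gen)
    (by
      filter_upwards [hv.mem_domain, hu.mem_domain] with t h1 h2
      exact (hasGenAt_gen h1).sub (hasGenAt_gen h2))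
    (by
      filter_upwards [ae_restrict_mem measurableSet_Ioc] with t ht
      exact (norm_sub_le _ _).trans ((add_le_add (hC₂ t ht) (hC₁ t ht)).trans (le_max_left _ _)))
  have hD0 := hD.eq_zero_of_nonpos
  have hL0 := hD.gen_eq_zero_of_nonpos
  have heq : ∀ T ∈ Ioc 0 T₀, ∫ y, D (T - y) ∂(tailMeasure ν) = ∫ y in Ioi 0, L (T - y) := by
    intro T hT
    have hsub : Ioc 0 T ⊆ Ioc 0 T₀ := Ioc_subset_Ioc_right hT.2
    rw [hS.levy.integral_tailMeasure hD0, integral_Ioi_sub_left hL0]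
    have h1 : ∫ s in Ioc 0 T, weight ν (T - s) • D s =
        ∫ s in Ioc 0 T, (weight ν (T - s) • (v s - g) - weight ν (T - s) • (u s - g)) := by
      refine integral_congr_ae ?_
      filter_upwards [ae_mono (Measure.restrict_mono hsub le_rfl) hDd] with s h2
      rw [h2, ← smul_sub, sub_sub_sub_cancel_right]
    have h3 : ∫ s in Ioc 0 T, L s =
        ∫ s in Ioc 0 T, ((f s + gen P (v s)) - (f s + gen P (u s))) := by
      refine integral_congr_ae ?_
      filter_upwards [ae_mono (Measure.restrict_mono hsub le_rfl) hLd] with s h2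
      rw [h2, add_sub_add_left_eq_sub]
    rw [h1, h3, integral_sub (hv.integrable_weight T hT) (hu.integrable_weight T hT),
      hv.equation T hT, hu.equation T hT, integral_sub]
    · exact (hf.mono_set hsub).add (hv.integrable_gen.mono_set hsub)
    · exact (hf.mono_set hsub).add (hu.integrable_gen.mono_set hsub)
  have hzero : ∀ t ∈ Ioc 0 T₀, ∫ s in Ioc 0 t, D s = ∫ s in Ioc 0 t, (0 : B) := by
    intro t ht
    have h1 : timeConv P (potentialMeasure S μ) (fun s => ∫ y, D (s - y) ∂(tailMeasure ν)) t =
        timeConv P (potentialMeasure S μ) (fun s => ∫ y in Ioi 0, L (s - y)) t := by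
      refine integral_congr_ae ?_
      filter_upwards [hm] with z hz
      congr 1
      rcases le_or_gt (t - z.1) 0 with h0 | h0
      · rw [integral_Ioi_sub_left hL0, hS.levy.integral_tailMeasure hD0, Ioc_eq_empty (not_lt.2 h0)]
        simp
      · exact heq _ ⟨h0, by linarith [hz.1, ht.2]⟩
    rw [timeConv_integral_sub hP hm hD.stronglyMeasurable t
        (integrable_prod_of_bounded hP hm hmT (ae_tailMeasure_pos ν)
          hS.levy.tailMeasure_Iic_lt_top hD.stronglyMeasurable hD.norm_le hD0 t)
        (fun s => hS.levy.integrable_tailMeasure hD.stronglyMeasurable hD0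
          fun r _ => hD.norm_le r),
      timeConv_integral_sub hP hm hD.stronglyMeasurable_gen t
        (integrable_prod_of_integrable hP hm hmT hD.stronglyMeasurable_gen hD.integrable_gen hL0 t)
        (fun s => (hD.integrable_gen.comp_sub_left s).integrableOn),
      hD.timeConv_eq_add hP hS hν hp, add_eq_right] at h1
    rw [h1, integral_zero]
  have hDae := ae_eq_of_integral_Ioc_eq hT₀ hD.integrable.integrableOn (integrable_zero _ _ _) hzero
  refine Measure.eqOn_Ioc_of_ae_eq (μ := volume) ?_ hv.continuousOn hu.continuousOn
  filter_upwards [hDae, hDd] with t h1 h2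
  exact sub_eq_zero.1 (h2.symm.trans h1)

end Solution

end TimeFractional

theorem theorem1p1
    {Ω : Type*} [MeasurableSpace Ω] (μ : MeasureTheory.Measure Ω)
    [MeasureTheory.IsProbabilityMeasure μ]
    {B : Type*} [NormedAddCommGroup B] [NormedSpace ℝ B] [CompleteSpace B]
    -- a driftless subordinator with infinite Lévy measure and bounded densities
    (S : ℝ → Ω → ℝ) (ν : MeasureTheory.Measure ℝ) (p : ℝ → ℝ → ℝ)
    (hS : TimeFractional.IsDriftlessSubordinator S ν μ)
    (hν : ν (Set.Ioi 0) = ⊤)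
    (hp : TimeFractional.HasBoundedDensities S μ p)
    -- a uniformly bounded strongly continuous semigroup
    (P : ℝ → B →L[ℝ] B) (hP : TimeFractional.IsBoundedC0Semigroup P)
    -- the data
    (T₀ : ℝ) (hT₀ : 0 < T₀)
    (g : B) (hg : g ∈ TimeFractional.genDomain P)
    (f : ℝ → B) (K : ℝ)
    (hfm : AEStronglyMeasurable f (volume.restrict (Set.Ioc 0 T₀)))
    (hfD : ∀ᵐ t ∂(volume.restrict (Set.Ioc 0 T₀)), f t ∈ TimeFractional.genDomain P)
    (hfL : IntegrableOn (fun t => TimeFractional.gen P (f t)) (Set.Ioc 0 T₀))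
    (hfK : ∀ᵐ t ∂(volume.restrict (Set.Ioc 0 T₀)), ‖f t‖ ≤ K) :
    -- all integrals that define `u t` converge absolutely, and its two expressions agree
    (∀ t ∈ Set.Ioc 0 T₀,
      Integrable (fun ω => P (TimeFractional.inverseSubordinator S t ω) g) μ ∧
      IntegrableOn (fun q : ℝ × ℝ => p q.2 (t - q.1) • P q.2 (f q.1))
        (Set.Ioc 0 t ×ˢ Set.Ioi 0) ∧
      Integrable
        (fun q : Ω × ℝ => if S q.2 q.1 < t then P q.2 (f (t - S q.2 q.1)) else 0)
        (μ.prod (volume.restrict (Set.Ioi 0))) ∧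
      TimeFractional.solution S μ p P f g t =
        (∫ ω, P (TimeFractional.inverseSubordinator S t ω) g ∂μ) +
          ∫ ω, (∫ r in Set.Ioi (0 : ℝ), if S r ω < t then P r (f (t - S r ω)) else 0) ∂μ) ∧
    -- existence
    TimeFractional.IsStrongSolution ν P T₀ f g (TimeFractional.solution S μ p P f g) ∧
    -- uniqueness
    (∀ v : ℝ → B, TimeFractional.IsStrongSolution ν P T₀ f g v →
      ∀ t ∈ Set.Ioc 0 T₀, v t = TimeFractional.solution S μ p P f g t) := by
  have hg' := TimeFractional.hasGenAt_gen hg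
  obtain ⟨F, H, hF, hfF, -⟩ := TimeFractional.exists_isRegular (P := P) (K := max K 0) (le_max_right _ _) hfm hfL
    (hfD.mono fun t ht => TimeFractional.hasGenAt_gen ht) (hfK.mono fun t ht => ht.trans (le_max_left _ _))
  have hin := fun t (ht : t ∈ Set.Ioc 0 T₀) => TimeFractional.inhomogeneous_term hP hS hν hp hF.stronglyMeasurable
    hF.norm_le hF.eq_zero hfF ht
  have hhom := fun t (ht : t ∈ Set.Ioc 0 T₀) => TimeFractional.inverseSubordinator_integral hP hS hν hp hg' ht
  have hsol : TimeFractional.IsStrongSolution ν P T₀ f g (TimeFractional.solution S μ p P f g) := by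
    refine TimeFractional.isStrongSolution_of_eq_timeConv hP hS hν hp hT₀ hg' hF hfF fun t ht => ?_
    rw [TimeFractional.solution, (hhom t ht).2, (hin t ht).2.2.1]
  refine ⟨fun t ht => ⟨(hhom t ht).1, (hin t ht).1, (hin t ht).2.1, ?_⟩, hsol, fun v hv t ht => ?_⟩
  · rw [TimeFractional.solution, (hin t ht).2.2.1, (hin t ht).2.2.2]
  · exact hsol.eqOn hP hS hν hp hT₀ (hF.integrable.integrableOn.congr hfF) hv ht
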